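/- Let $\mathbb{F}_q$ be a finite field, $n\ge 2$, and let $\mathcal X\subset\mathbb{P}^n(\overline{\mathbb{F}}_q)$ be an irreducible projective curve of degree $d$ defined over $\mathbb{F}_q$, with function field $\overline{\mathbb F}_q(\mathcal X)$ and order sequence $\varepsilon_0<\cdots<\varepsilon_n$; that is, at all but finitely many points $P\in\mathcal X$, $P$ is nonsingular and the (finite) intersection multiplicities at $P$ of $\mathcal X$ with hyperplanes are exactly $\varepsilon_0,\dots,\varepsilon_n$. For a nonsingular point $P$, the osculating hyperplane $H_P$ is the hyperplane whose intersection multiplicity with $\mathcal X$ at $P$ is the largest possible one. The (strict) Gauss map $\gamma:\mathcal X\to\mathcal X'$ sends $P$ to the point of the dual projective space corresponding to $H_P$, where the strict dual curve $\mathcal X'$ is the closure of the image. Its separable degree $\deg_s\gamma$ is the separable degree of the field extension $\overline{\mathbb F}_q(\mathcal X)/\gamma^*\overline{\mathbb F}_q(\mathcal X')$. For $i\ge 1$, the $\mathbb{F}_{q^i}$-Frobenius order sequence $(\nu_0^{(i)},\dots,\nu_{n-1}^{(i)})$ of $\mathcal X$ is the lexicographically smallest sequence of non-negative integers $(\nu_0,\dots,\nu_{n-1})$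 such that the determinant with rows $(x_0^{q^i},\dots,x_n^{q^i})$ and $(D_t^{(\nu_k)}x_0,\dots,D_t^{(\nu_k)}x_n)$, $k=0,\dots,n-1$, is nonzero. Here $x_0,\dots,x_n\in\mathbb{F}_q(\mathcal X)$ are the coordinate functions of $\mathcal X$ (normalised so that one of them is $1$), $t$ is a separating element of $\overline{\mathbb F}_q(\mathcal X)/\overline{\mathbb F}_q$, and $D_t^{(k)}$ is the $k$-th Hasse derivative with respect to $t$. The curve $\mathcal X$ is called $\mathbb{F}_{q^i}$-Frobenius nonclassical if $(\nu_0^{(i)},\dots,\nu_{n-1}^{(i)})\neq(0,1,\dots,n-1)$. Let $1\le \ell<n$, and suppose that for every $i=1,\dots,\ell$ the curve $\mathcal X$ is $\mathbb{F}_{q^i}$-Frobenius nonclassical and the last term of its $\mathbb{F}_{q^i}$-Frobenius order sequence is $\nu^{(i)}_{n-1}=\varepsilon_n$. Then $\gamma$ has finite degree, i.e. the extension $\overline{\mathbb F}_q(\mathcal X)/\gamma^*\overline{\mathbb F}_q(\mathcal X')$ is finite, and $$\deg_s\gamma\;\le\;\frac{d}{\varepsilon_n+\ell}.$$ -/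

import Mathlib

noncomputable section

/-- The length of the quotient ring `R / I`. -/
def colength {R : Type*} [CommRing R] (I : Ideal R) : ℕ∞ := Module.length R (R ⧸ I)

/-- A projective curve in `ℙⁿ(K)` (for `K` algebraically closed): it is given by its homogeneous
ideal, which is prime (irreducibility), the affine cone having dimension two. -/
structure ProjectiveCurve (K : Type*) [Field K] (n : ℕ) where
  /-- The homogeneous ideal of the curve. -/
  ideal : Ideal (MvPolynomial (Fin (n + 1)) K)
  isHomogeneous : ∀ f ∈ ideal, ∀ m, MvPolynomial.homogeneousComponent m f ∈ ideal
  isPrime : ideal.IsPrime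
  dim_cone : ringKrullDim (MvPolynomial (Fin (n + 1)) K ⧸ ideal) = 2

namespace ProjectiveCurve

variable {K : Type*} [Field K] {n : ℕ} (X : ProjectiveCurve K n)

instance : X.ideal.IsPrime := X.isPrime

/-- The curve is defined over the subfield `F`: its ideal is generated by polynomials with
coefficients in `F`. -/
def IsDefinedOver (F : Type*) [Field F] [Algebra F K] : Prop :=
  ∃ J : Ideal (MvPolynomial (Fin (n + 1)) F),
    X.ideal = J.map (MvPolynomial.map (algebraMap F K))

/-- The points of the curve. -/
def points : Set (Projectivization K (Fin (n + 1) → K)) :=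
  {P | ∀ f ∈ X.ideal, MvPolynomial.eval P.rep f = 0}

/-- The homogeneous coordinate ring. -/
abbrev CoordRing : Type _ := MvPolynomial (Fin (n + 1)) K ⧸ X.ideal

/-- The fraction field of the homogeneous coordinate ring. -/
def ConeField : Type _ := FractionRing X.CoordRing

instance : Field X.ConeField := inferInstanceAs (Field (FractionRing X.CoordRing))

instance : Algebra X.CoordRing X.ConeField :=
  inferInstanceAs (Algebra X.CoordRing (FractionRing X.CoordRing))

instance : Algebra K X.ConeField := inferInstanceAs (Algebra K (FractionRing X.CoordRing))

instance : IsScalarTower K X.CoordRing X.ConeField :=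
  inferInstanceAs (IsScalarTower K X.CoordRing (FractionRing X.CoordRing))

instance : IsFractionRing X.CoordRing X.ConeField :=
  inferInstanceAs (IsFractionRing X.CoordRing (FractionRing X.CoordRing))

/-- The class of a polynomial in the fraction field of the homogeneous coordinate ring. -/
def toCone : MvPolynomial (Fin (n + 1)) K →ₐ[K] X.ConeField :=
  (IsScalarTower.toAlgHom K X.CoordRing X.ConeField).comp (Ideal.Quotient.mkₐ K X.ideal)

lemma toCone_eq_zero_iff (f : MvPolynomial (Fin (n + 1)) K) :
    X.toCone f = 0 ↔ f ∈ X.ideal := by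
  rw [← Ideal.Quotient.eq_zero_iff_mem]
  exact map_eq_zero_iff (algebraMap X.CoordRing X.ConeField)
    (IsFractionRing.injective X.CoordRing X.ConeField)

lemma toCone_ne_zero (P : X.points) {g : MvPolynomial (Fin (n + 1)) K}
    (hg : MvPolynomial.eval P.1.rep g ≠ 0) : X.toCone g ≠ 0 := fun h =>
  hg (P.2 g ((X.toCone_eq_zero_iff g).1 h))

/-- The function field `K(X)`: quotients `f / g` of forms of the same degree, `g` not vanishing
identically on the curve. -/
def functionField : IntermediateField K X.ConeField where
  carrier := {y | ∃ (m : ℕ) (f g : MvPolynomial (Fin (n + 1)) K), f.IsHomogeneous m ∧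
    g.IsHomogeneous m ∧ X.toCone g ≠ 0 ∧ y = X.toCone f / X.toCone g}
  mul_mem' := by
    rintro _ _ ⟨m, f, g, hf, hg, h0, rfl⟩ ⟨m', f', g', hf', hg', h0', rfl⟩
    refine ⟨m + m', f * f', g * g', hf.mul hf', hg.mul hg', ?_, ?_⟩
    · rw [map_mul]; exact mul_ne_zero h0 h0'
    · rw [map_mul, map_mul, div_mul_div_comm]
  add_mem' := by
    rintro _ _ ⟨m, f, g, hf, hg, h0, rfl⟩ ⟨m', f', g', hf', hg', h0', rfl⟩
    refine ⟨m + m', f * g' + g * f', g * g', (hf.mul hg').add (hg.mul hf'), hg.mul hg', ?_, ?_⟩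
    · rw [map_mul]; exact mul_ne_zero h0 h0'
    · rw [map_add, map_mul, map_mul, map_mul, div_add_div _ _ h0 h0']
  algebraMap_mem' := fun c =>
    ⟨0, MvPolynomial.C c, 1, MvPolynomial.isHomogeneous_C _ c, MvPolynomial.isHomogeneous_one _ _,
      by rw [map_one]; exact one_ne_zero, by
        rw [map_one, div_one]; exact (X.toCone.commutes c).symm⟩
  inv_mem' := by
    rintro _ ⟨m, f, g, hf, hg, h0, rfl⟩
    by_cases h : X.toCone f = 0
    · exact ⟨0, 0, 1, MvPolynomial.isHomogeneous_zero _ _ _, MvPolynomial.isHomogeneous_one _ _,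
        by rw [map_one]; exact one_ne_zero, by simp [h]⟩
    · exact ⟨m, g, f, hg, hf, h, inv_div _ _⟩

/-- The local ring `𝒪_{X,P}`: quotients `f / g` of forms of the same degree with `g(P) ≠ 0`. -/
def localRing (P : X.points) : Subalgebra K X.ConeField where
  carrier := {y | ∃ (m : ℕ) (f g : MvPolynomial (Fin (n + 1)) K), f.IsHomogeneous m ∧
    g.IsHomogeneous m ∧ MvPolynomial.eval P.1.rep g ≠ 0 ∧ y = X.toCone f / X.toCone g}
  mul_mem' := by
    rintro _ _ ⟨m, f, g, hf, hg, h0, rfl⟩ ⟨m', f', g', hf', hg', h0', rfl⟩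
    refine ⟨m + m', f * f', g * g', hf.mul hf', hg.mul hg', ?_, ?_⟩
    · rw [map_mul]; exact mul_ne_zero h0 h0'
    · rw [map_mul, map_mul, div_mul_div_comm]
  add_mem' := by
    rintro _ _ ⟨m, f, g, hf, hg, h0, rfl⟩ ⟨m', f', g', hf', hg', h0', rfl⟩
    refine ⟨m + m', f * g' + g * f', g * g', (hf.mul hg').add (hg.mul hf'), hg.mul hg', ?_, ?_⟩
    · rw [map_mul]; exact mul_ne_zero h0 h0'
    · rw [map_add, map_mul, map_mul, map_mul,
        div_add_div _ _ (X.toCone_ne_zero P h0) (X.toCone_ne_zero P h0')]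
  algebraMap_mem' := fun c =>
    ⟨0, MvPolynomial.C c, 1, MvPolynomial.isHomogeneous_C _ c, MvPolynomial.isHomogeneous_one _ _,
      by rw [map_one]; exact one_ne_zero, by
        rw [map_one, div_one]; exact (X.toCone.commutes c).symm⟩

/-- The rational function `y` is regular at `P` and takes the value `c` there. -/
def HasValueAt (P : X.points) (y : X.ConeField) (c : K) : Prop :=
  ∃ (m : ℕ) (f g : MvPolynomial (Fin (n + 1)) K), f.IsHomogeneous m ∧ g.IsHomogeneous m ∧
    MvPolynomial.eval P.1.rep g ≠ 0 ∧ y = X.toCone f / X.toCone g ∧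
    c = MvPolynomial.eval P.1.rep f / MvPolynomial.eval P.1.rep g

/-- `P` is a nonsingular point: its local ring, which has dimension one, is regular. -/
def IsNonsingular (P : X.points) : Prop := IsDiscreteValuationRing (X.localRing P)

/-- The linear form defining a hyperplane, the latter given as a point of the dual projective
space in dual coordinates. -/
def linearForm (H : Projectivization K (Fin (n + 1) → K)) : MvPolynomial (Fin (n + 1)) K :=
  ∑ i, MvPolynomial.C (H.rep i) * MvPolynomial.X i

/-- The ideal of `𝒪_{X,P}` generated by a local equation `h / x_j` of the hyperplane `H`, where
`x_j` is any coordinate with `x_j(P) ≠ 0`. -/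
def hyperplaneIdeal (P : X.points) (H : Projectivization K (Fin (n + 1) → K)) :
    Ideal (X.localRing P) :=
  Ideal.span {y | ∃ j, P.1.rep j ≠ 0 ∧
    (y : X.ConeField) = X.toCone (linearForm H) / X.toCone (MvPolynomial.X j)}

/-- The intersection multiplicity at `P` of the curve and the hyperplane `H`,
the length of `𝒪_{X,P} / (h / x_j)` (it is `⊤` if the curve lies in `H`). -/
def interMult (P : X.points) (H : Projectivization K (Fin (n + 1) → K)) : ℕ∞ :=
  colength (X.hyperplaneIdeal P H)

/-- The set of orders at `P`: all the finite intersection multiplicities at `P` of the curve with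
hyperplanes. -/
def orders (P : X.points) : Set ℕ :=
  {k | ∃ H : Projectivization K (Fin (n + 1) → K), X.interMult P H = (k : ℕ∞)}

/-- `(ε₀ < ⋯ < εₙ)` is the order sequence of the curve: all points but finitely many are nonsingular
with set of orders `{ε₀, …, εₙ}`. -/
def IsOrderSequence (ε : Fin (n + 1) → ℕ) : Prop :=
  StrictMono ε ∧
    {P : X.points | ¬ (X.IsNonsingular P ∧ X.orders P = Set.range ε)}.Finite

/-- `d` is the degree of the curve: its Hilbert polynomial is `d m + c` for some constant `c`. -/
def HasDegree (d : ℕ) : Prop :=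
  ∃ c : ℤ, ∀ᶠ m : ℕ in Filter.atTop,
    (Module.finrank K ((MvPolynomial.homogeneousSubmodule (Fin (n + 1)) K m).map
      (Ideal.Quotient.mkₐ K X.ideal).toLinearMap) : ℤ) = d * m + c

/-- `t` is a separating element of `L / K`. -/
def IsSeparating (K : Type*) {L : Type*} [Field K] [Field L] [Algebra K L] (t : L) : Prop :=
  Algebra.IsSeparable (IntermediateField.adjoin K {t}) L

/-- `D k` is the `k`-th Hasse derivative on `L / K` with respect to `t`, for every `k`. For a
separating element `t` there is exactly one such family. -/
structure IsHasseDerivative {K L : Type*} [Field K] [Field L] [Algebra K L] (t : L)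
    (D : ℕ → L →ₗ[K] L) : Prop where
  zero : ∀ f, D 0 f = f
  leibniz : ∀ k f g, D k (f * g) = ∑ ij ∈ Finset.HasAntidiagonal.antidiagonal k, D ij.1 f * D ij.2 g
  one_self : D 1 t = 1
  self : ∀ k, 2 ≤ k → D k t = 0

/-- The determinant with rows `(x₀^Q, …, xₙ^Q)` and `(D^{(ν_k)} x₀, …, D^{(ν_k)} xₙ)`, `k < n`. -/
def frobeniusDet {K L : Type*} [Field K] [Field L] [Algebra K L] (D : ℕ → L →ₗ[K] L)
    (x : Fin (n + 1) → L) (Q : ℕ) (ν : Fin n → ℕ) : L :=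
  Matrix.det (Matrix.of (Matrix.vecCons (fun i => x i ^ Q) (fun k i => D (ν k) (x i))))

/-- `ν` is the `𝔽_Q`-Frobenius order sequence of the curve: the lexicographically minimal sequence
for which the Frobenius determinant, formed with coordinate functions `x_i / x_j` and a separating
element `t`, is nonzero. -/
def IsFrobeniusOrderSequence (Q : ℕ) (ν : Fin n → ℕ) : Prop :=
  ∃ (t : X.functionField) (D : ℕ → X.functionField →ₗ[K] X.functionField)
    (x : Fin (n + 1) → X.functionField) (j : Fin (n + 1)),
    IsSeparating K t ∧ IsHasseDerivative t D ∧
    X.toCone (MvPolynomial.X j) ≠ 0 ∧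
    (∀ i, (x i : X.ConeField) = X.toCone (MvPolynomial.X i) / X.toCone (MvPolynomial.X j)) ∧
    IsLeast {μ : Lex (Fin n → ℕ) | frobeniusDet D x Q (ofLex μ) ≠ 0} (toLex ν)

/-- The curve is `𝔽_Q`-Frobenius nonclassical, with Frobenius order sequence `ν`. -/
def IsFrobeniusNonclassicalWith (Q : ℕ) (ν : Fin n → ℕ) : Prop :=
  X.IsFrobeniusOrderSequence Q ν ∧ ν ≠ fun k : Fin n => (k : ℕ)

/-- `H` is the osculating hyperplane at the nonsingular point `P`, that is, the value at `P` of the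
strict Gauss map `γ`: the intersection multiplicity at `P` is the largest order at `P`. -/
def IsOsculatingHyperplane (P : X.points) (H : Projectivization K (Fin (n + 1) → K)) : Prop :=
  X.IsNonsingular P ∧ ∃ k : ℕ, IsGreatest (X.orders P) k ∧ X.interMult P H = (k : ℕ∞)

/-- The subfield `γ^* K(X')` of `K(X)`, where `X'` is the strict dual curve, the closure of the
image of the Gauss map `γ`: the rational functions on `X` of the form `(A / B) ∘ γ`, where `A`, `B`
are forms of the same degree on the dual projective space and `B` does not vanish identically
on `X'`. -/
def dualFunctionField : IntermediateField K X.functionField :=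
  IntermediateField.adjoin K {f | ∃ (m : ℕ) (A B : MvPolynomial (Fin (n + 1)) K),
    A.IsHomogeneous m ∧ B.IsHomogeneous m ∧
    {P : X.points | ¬ ∃ H, X.IsOsculatingHyperplane P H ∧ MvPolynomial.eval H.rep B ≠ 0 ∧
      X.HasValueAt P f (MvPolynomial.eval H.rep A / MvPolynomial.eval H.rep B)}.Finite}

/-- The separable degree of the strict Gauss map `γ : X → X'`. -/
def gaussSepDegree : ℕ := Field.finSepDegree X.dualFunctionField X.functionField

end ProjectiveCurve

end

noncomputable section

namespace ProjectiveCurve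

open MvPolynomial

section

/-! At a general point $P$ the osculating hyperplane $H_P$ meets the curve with multiplicity
$\varepsilon_n$. The assumption $\nu^{(i)}_{n-1}=\varepsilon_n$ puts the $i$-th Frobenius image of
$P$ on $H_P$ too, for $1\le i\le\ell$. The $\deg_s\gamma$ points of a general fibre of $\gamma$
share one hyperplane. If these points and their Frobenius images are all distinct, the fibre
accounts for $\deg_s\gamma\cdot(\varepsilon_n+\ell)$ intersections, and Bézout allows at most $d$.

Frobenius images: since $\nu^{(i)}$ ends in $\varepsilon_n$, it is not
$(\varepsilon_0,\dots,\varepsilon_{n-1})$, and lexicographic minimality then makes the Frobenius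
determinant for $(\varepsilon_0,\dots,\varepsilon_{n-1})$ vanish (`frobeniusDet_orders_eq_zero`). A
kernel vector of this matrix at $P$ is orthogonal to the derivatives of orders
$\varepsilon_0,\dots,\varepsilon_{n-1}$, hence is $H_P$, and it is also orthogonal to the Frobenius
row (`IsGenericPoint.dotProduct_pow_eq_zero`).

The fibre: the separable degree counts the embeddings of the function field, over the field of the
dual curve, into an algebraic closure $\Omega$. Each embedding is a generic point of the curve with
coordinates in $\Omega$, and all have the same Gauss image. They are specialized together to points
over the algebraically closed base field (`IsCoord.exists_points`). No embedding is a Frobenius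
twist of another (`IsCoord.not_forall_eq_pow`), so the specialization can be chosen to keep all the
points distinct. `card_mul_le` then applies a Bézout inequality derived from the Hilbert polynomial
(`IsCoord.sum_le_of_isCoprime`).

Finiteness: some Gauss coordinate is not constant (`IsGaussCoord.exists_transcendental`), and linear
growth of the Hilbert function leaves no room for a second independent transcendental
(`IsCoord.isAlgebraic`). -/

lemma _root_.MvPolynomial.IsHomogeneous.aeval_mul_left {σ R B : Type*} [CommSemiring R]
    [CommSemiring B] [Algebra R B] {F : MvPolynomial σ R} {m : ℕ} (hF : F.IsHomogeneous m)
    (a : B) (v : σ → B) : aeval (fun i => a * v i) F = a ^ m * aeval v F := by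
  rw [aeval_def, aeval_def, eval₂_eq, eval₂_eq, Finset.mul_sum]
  refine Finset.sum_congr rfl fun s hs => ?_
  rw [mul_left_comm]
  congr 1
  have : m = ∑ i ∈ s.support, s i := by
    rw [← hF (mem_support_iff.1 hs), Finsupp.weight_apply, Finsupp.sum]
    simp
  rw [this, ← Finset.prod_pow_eq_pow_sum, ← Finset.prod_mul_distrib]
  exact Finset.prod_congr rfl fun i _ => mul_pow _ _ _

variable {K : Type*} [Field K] {n : ℕ} (X : ProjectiveCurve K n)

/-! ### Values of rational functions at points -/

variable {X} in
lemma HasValueAt.unique {P : X.points} {y : X.ConeField} {c c' : K}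
    (h : X.HasValueAt P y c) (h' : X.HasValueAt P y c') : c = c' := by
  obtain ⟨m, f, g, hf, hg, h0, rfl, rfl⟩ := h
  obtain ⟨m', f', g', hf', hg', h0', he, rfl⟩ := h'
  rw [div_eq_div_iff (X.toCone_ne_zero P h0) (X.toCone_ne_zero P h0'), ← map_mul, ← map_mul,
    ← sub_eq_zero, ← map_sub, toCone_eq_zero_iff] at he
  have := P.2 _ he
  rw [map_sub, map_mul, map_mul, sub_eq_zero] at this
  rwa [div_eq_div_iff h0 h0']

lemma mem_localRing_iff {P : X.points} {y : X.ConeField} :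
    y ∈ X.localRing P ↔ ∃ c, X.HasValueAt P y c :=
  ⟨fun ⟨m, f, g, hf, hg, h0, h⟩ => ⟨_, m, f, g, hf, hg, h0, h, rfl⟩,
    fun ⟨_, m, f, g, hf, hg, h0, h, _⟩ => ⟨m, f, g, hf, hg, h0, h⟩⟩

variable {X} in
lemma HasValueAt.add {P : X.points} {y y' : X.ConeField} {c c' : K}
    (h : X.HasValueAt P y c) (h' : X.HasValueAt P y' c') : X.HasValueAt P (y + y') (c + c') := by
  obtain ⟨m, f, g, hf, hg, h0, rfl, rfl⟩ := h
  obtain ⟨m', f', g', hf', hg', h0', rfl, rfl⟩ := h'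
  refine ⟨m + m', f * g' + g * f', g * g', (hf.mul hg').add (hg.mul hf'), hg.mul hg', ?_, ?_, ?_⟩
  · rw [map_mul]; exact mul_ne_zero h0 h0'
  · rw [map_add, map_mul, map_mul, map_mul,
      div_add_div _ _ (X.toCone_ne_zero P h0) (X.toCone_ne_zero P h0')]
  · rw [map_add, map_mul, map_mul, map_mul, div_add_div _ _ h0 h0']

variable {X} in
lemma HasValueAt.mul {P : X.points} {y y' : X.ConeField} {c c' : K}
    (h : X.HasValueAt P y c) (h' : X.HasValueAt P y' c') : X.HasValueAt P (y * y') (c * c') := by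
  obtain ⟨m, f, g, hf, hg, h0, rfl, rfl⟩ := h
  obtain ⟨m', f', g', hf', hg', h0', rfl, rfl⟩ := h'
  refine ⟨m + m', f * f', g * g', hf.mul hf', hg.mul hg', ?_, ?_, ?_⟩
  · rw [map_mul]; exact mul_ne_zero h0 h0'
  · rw [map_mul, map_mul, div_mul_div_comm]
  · rw [map_mul, map_mul, div_mul_div_comm]

lemma hasValueAt_algebraMap (P : X.points) (c : K) :
    X.HasValueAt P (algebraMap K X.ConeField c) c :=
  ⟨0, C c, 1, isHomogeneous_C _ c, isHomogeneous_one _ _, by simp, by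
    rw [map_one, div_one]; exact (X.toCone.commutes c).symm, by simp⟩

variable {X} in
lemma HasValueAt.inv {P : X.points} {y : X.ConeField} {c : K}
    (h : X.HasValueAt P y c) (hc : c ≠ 0) : X.HasValueAt P y⁻¹ c⁻¹ := by
  obtain ⟨m, f, g, hf, hg, h0, rfl, rfl⟩ := h
  exact ⟨m, g, f, hg, hf, (div_ne_zero_iff.1 hc).1, inv_div _ _, inv_div _ _⟩

/-- The rational functions that are regular at `P`, as a subring of the function field. -/
def regularAt (P : X.points) : Subalgebra K X.functionField :=
  (X.localRing P).comap X.functionField.val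

open Classical in
/-- The value at `P` of a rational function regular there (zero if it is not regular). -/
def valueAt (P : X.points) (y : X.functionField) : K :=
  if h : ∃ c, X.HasValueAt P y c then h.choose else 0

variable {X}
variable {P : X.points} {y z : X.functionField}

lemma mem_regularAt : y ∈ X.regularAt P ↔ ∃ c, X.HasValueAt P y c := X.mem_localRing_iff

lemma HasValueAt.mem_regularAt {c : K} (h : X.HasValueAt P y c) : y ∈ X.regularAt P :=
  ProjectiveCurve.mem_regularAt.2 ⟨c, h⟩

lemma HasValueAt.valueAt_eq {c : K} (h : X.HasValueAt P y c) : X.valueAt P y = c := by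
  have h' : ∃ c, X.HasValueAt P y c := ⟨c, h⟩
  rw [valueAt, dif_pos h']
  exact h'.choose_spec.unique h

lemma hasValueAt_valueAt (h : y ∈ X.regularAt P) : X.HasValueAt P y (X.valueAt P y) := by
  obtain ⟨c, h⟩ := mem_regularAt.1 h
  rwa [h.valueAt_eq]

lemma valueAt_add (hy : y ∈ X.regularAt P) (hz : z ∈ X.regularAt P) :
    X.valueAt P (y + z) = X.valueAt P y + X.valueAt P z :=
  HasValueAt.valueAt_eq (y := y + z) ((hasValueAt_valueAt hy).add (hasValueAt_valueAt hz))

lemma valueAt_mul (hy : y ∈ X.regularAt P) (hz : z ∈ X.regularAt P) :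
    X.valueAt P (y * z) = X.valueAt P y * X.valueAt P z :=
  HasValueAt.valueAt_eq (y := y * z) ((hasValueAt_valueAt hy).mul (hasValueAt_valueAt hz))

@[simp]
lemma valueAt_algebraMap (c : K) : X.valueAt P (algebraMap K X.functionField c) = c :=
  HasValueAt.valueAt_eq (y := algebraMap K X.functionField c) (X.hasValueAt_algebraMap P c)

@[simp]
lemma valueAt_one : X.valueAt P 1 = 1 := by
  simpa using valueAt_algebraMap (P := P) (1 : K)

@[simp]
lemma valueAt_zero : X.valueAt P 0 = 0 := by
  simpa using valueAt_algebraMap (P := P) (0 : K)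

lemma inv_mem_regularAt (hy : y ∈ X.regularAt P) (h0 : X.valueAt P y ≠ 0) :
    y⁻¹ ∈ X.regularAt P :=
  HasValueAt.mem_regularAt (y := y⁻¹) ((hasValueAt_valueAt hy).inv h0)

lemma valueAt_smul (c : K) (hy : y ∈ X.regularAt P) :
    X.valueAt P (c • y) = c * X.valueAt P y := by
  rw [Algebra.smul_def, valueAt_mul (Subalgebra.algebraMap_mem _ c) hy, valueAt_algebraMap]

/-- Evaluation at `P`, as a homomorphism on the ring of functions that are regular there. -/
def evalAt (P : X.points) : X.regularAt P →ₐ[K] K where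
  toFun y := X.valueAt P y
  map_one' := valueAt_one
  map_zero' := valueAt_zero
  map_mul' y z := valueAt_mul y.2 z.2
  map_add' y z := valueAt_add y.2 z.2
  commutes' c := valueAt_algebraMap c

lemma evalAt_apply (y : X.regularAt P) : evalAt P y = X.valueAt P y := rfl

lemma valueAt_sum {ι : Type*} (s : Finset ι) (f : ι → X.functionField)
    (hf : ∀ i ∈ s, f i ∈ X.regularAt P) :
    X.valueAt P (∑ i ∈ s, f i) = ∑ i ∈ s, X.valueAt P (f i) := by
  classical
  induction s using Finset.induction_on with
  | empty => simp
  | insert a s ha ih =>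
    rw [Finset.sum_insert ha, Finset.sum_insert ha, valueAt_add (hf a (by simp))
      (Subalgebra.sum_mem _ fun i hi => hf i (by simp [hi])), ih fun i hi => hf i (by simp [hi])]

lemma valueAt_pow (hy : y ∈ X.regularAt P) (k : ℕ) :
    X.valueAt P (y ^ k) = X.valueAt P y ^ k :=
  map_pow (evalAt P) ⟨y, hy⟩ k

/-! ### Affine charts -/

variable (X) in
/-- The functions `x_i` are the quotients `X_i / X_j` of the coordinates by the `j`-th one. -/
structure IsCoord (j : Fin (n + 1)) (x : Fin (n + 1) → X.functionField) : Prop where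
  ne_zero : X.toCone (MvPolynomial.X j) ≠ 0
  eq_div : ∀ i, (x i : X.ConeField) = X.toCone (MvPolynomial.X i) / X.toCone (MvPolynomial.X j)

lemma exists_isCoord {j : Fin (n + 1)} (hj : X.toCone (MvPolynomial.X j) ≠ 0) :
    ∃ x, X.IsCoord j x :=
  ⟨fun i => ⟨X.toCone (MvPolynomial.X i) / X.toCone (MvPolynomial.X j), 1, _, _,
    isHomogeneous_X _ _, isHomogeneous_X _ _, hj, rfl⟩, hj, fun _ => rfl⟩

namespace IsCoord

variable {j : Fin (n + 1)} {x : Fin (n + 1) → X.functionField} (hx : X.IsCoord j x)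
include hx

lemma self : x j = 1 := by
  apply Subtype.ext
  rw [hx.eq_div, div_self hx.ne_zero]; rfl

lemma coe_aeval {F : MvPolynomial (Fin (n + 1)) K} {m : ℕ} (hF : F.IsHomogeneous m) :
    ((aeval x F : X.functionField) : X.ConeField) =
      X.toCone F / X.toCone (MvPolynomial.X j) ^ m := by
  have h1 : ((aeval x F : X.functionField) : X.ConeField) =
      aeval (fun i => (x i : X.ConeField)) F :=
    (congrArg (fun φ => φ F) (comp_aeval x X.functionField.val) : _)
  have h2 : X.toCone F = aeval (fun i => X.toCone (MvPolynomial.X i)) F :=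
    congrArg (fun φ => φ F) (aeval_unique X.toCone)
  have h3 : (fun i => X.toCone (MvPolynomial.X i)) =
      fun i => X.toCone (MvPolynomial.X j) * (x i : X.ConeField) := by
    ext i; rw [hx.eq_div, mul_div_cancel₀ _ hx.ne_zero]
  rw [h1, h2, h3, hF.aeval_mul_left, mul_div_cancel_left₀ _ (pow_ne_zero _ hx.ne_zero)]

lemma aeval_eq_zero_iff {F : MvPolynomial (Fin (n + 1)) K} {m : ℕ} (hF : F.IsHomogeneous m) :
    aeval x F = 0 ↔ F ∈ X.ideal := by
  rw [← toCone_eq_zero_iff, ← ZeroMemClass.coe_eq_zero, hx.coe_aeval hF, div_eq_zero_iff,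
    or_iff_left (pow_ne_zero _ hx.ne_zero)]

lemma exists_eq_div (y : X.functionField) : ∃ (m : ℕ) (f g : MvPolynomial (Fin (n + 1)) K),
    f.IsHomogeneous m ∧ g.IsHomogeneous m ∧ aeval x g ≠ 0 ∧ y = aeval x f / aeval x g := by
  obtain ⟨y, m, f, g, hf, hg, h0, rfl⟩ := y
  refine ⟨m, f, g, hf, hg, ?_, ?_⟩
  · rwa [Ne, hx.aeval_eq_zero_iff hg, ← toCone_eq_zero_iff]
  · apply Subtype.ext
    change _ = ((aeval x f : X.functionField) : X.ConeField) / ((aeval x g : X.functionField) : _)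
    rw [hx.coe_aeval hf, hx.coe_aeval hg, div_div_div_cancel_right₀ (pow_ne_zero _ hx.ne_zero)]

lemma hasValueAt (hP : P.1.rep j ≠ 0) (i : Fin (n + 1)) :
    X.HasValueAt P (x i) (P.1.rep i / P.1.rep j) :=
  ⟨1, MvPolynomial.X i, MvPolynomial.X j, isHomogeneous_X _ _, isHomogeneous_X _ _,
    by simpa using hP, hx.eq_div i, by simp⟩

lemma mem_regularAt (hP : P.1.rep j ≠ 0) (i : Fin (n + 1)) : x i ∈ X.regularAt P :=
  (hx.hasValueAt hP i).mem_regularAt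

lemma valueAt_eq (hP : P.1.rep j ≠ 0) (i : Fin (n + 1)) :
    X.valueAt P (x i) = P.1.rep i / P.1.rep j :=
  (hx.hasValueAt hP i).valueAt_eq

lemma aeval_mem_regularAt (hP : P.1.rep j ≠ 0) (F : MvPolynomial (Fin (n + 1)) K) :
    aeval x F ∈ X.regularAt P := by
  rw [aeval_def, eval₂_eq]
  exact Subalgebra.sum_mem _ fun s _ => Subalgebra.mul_mem _ (Subalgebra.algebraMap_mem _ _)
    (Subalgebra.prod_mem _ fun i _ => Subalgebra.pow_mem _ (hx.mem_regularAt hP i) _)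

lemma valueAt_aeval (hP : P.1.rep j ≠ 0) (F : MvPolynomial (Fin (n + 1)) K) :
    X.valueAt P (aeval x F) = eval (fun i => P.1.rep i / P.1.rep j) F := by
  let ψ : MvPolynomial (Fin (n + 1)) K →ₐ[K] X.regularAt P :=
    aeval fun i => (⟨x i, hx.mem_regularAt hP i⟩ : X.regularAt P)
  have h : (X.regularAt P).val.comp ψ = aeval x := by
    ext i; simp [ψ]
  have h2 : (evalAt P).comp ψ = aeval (fun i => P.1.rep i / P.1.rep j) := by
    ext i; simp [ψ, evalAt_apply, hx.valueAt_eq hP i]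
  rw [← h]
  change (evalAt P).comp ψ F = _
  rw [h2]; rfl

/-- Homogenization: the component of degree $i$ is multiplied by $X_j^{m-i}$, which is $1$ in the
chart. -/
lemma exists_aeval_eq (F : MvPolynomial (Fin (n + 1)) K) {m : ℕ} (hm : F.totalDegree ≤ m) :
    ∃ G : MvPolynomial (Fin (n + 1)) K, G.IsHomogeneous m ∧ aeval x G = aeval x F ∧
      ∀ p : Fin (n + 1) → K, p j = 1 → eval p G = eval p F := by
  refine ⟨∑ i ∈ Finset.range (m + 1),
    MvPolynomial.X j ^ (m - i) * homogeneousComponent i F, ?_, ?_, ?_⟩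
  · refine IsHomogeneous.sum _ _ _ fun i hi => ?_
    have := ((isHomogeneous_X K j).pow (m - i)).mul (homogeneousComponent_isHomogeneous i F)
    have hi := Finset.mem_range.1 hi
    rwa [one_mul, Nat.sub_add_cancel (by omega)] at this
  all_goals
    have hF : F = ∑ i ∈ Finset.range (m + 1), homogeneousComponent i F := by
      conv_lhs => rw [← sum_homogeneousComponent F]
      refine Finset.sum_subset (fun i hi => ?_) fun i _ hi => ?_
      · simp only [Finset.mem_range] at *; omega
      · exact homogeneousComponent_eq_zero _ _ (by simp only [Finset.mem_range] at *; omega)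
  · conv_rhs => rw [hF]
    simp [hx.self]
  · intro p hp
    conv_rhs => rw [hF]
    simp [hp]

/-- Turns a specialization of the affine coordinate ring into a point of the curve. -/
lemma exists_point (p : Fin (n + 1) → K) (hp : p j = 1)
    (h : ∀ F, aeval x F = 0 → eval p F = 0) :
    ∃ P : X.points, P.1.rep j ≠ 0 ∧ ∀ i, P.1.rep i / P.1.rep j = p i := by
  have hp0 : p ≠ 0 := fun h0 => by simp [h0] at hp
  obtain ⟨a, ha⟩ := Projectivization.exists_smul_eq_mk_rep K p hp0
  refine ⟨⟨Projectivization.mk K p hp0, fun f hf => ?_⟩, ?_, ?_⟩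
  · rw [← ha, ← sum_homogeneousComponent f, map_sum]
    refine Finset.sum_eq_zero fun i _ => ?_
    have hi := homogeneousComponent_isHomogeneous i f
    have h0 := h _ ((hx.aeval_eq_zero_iff hi).2 (X.isHomogeneous f hf i))
    exact (hi.aeval_mul_left (a : K) p).trans (by
      rw [← coe_aeval_eq_eval] at h0; exact (congrArg _ h0).trans (mul_zero _))
  · rw [← ha]; simp [hp, Units.smul_def]
  · intro i
    rw [← ha]; simp [hp, Units.smul_def]

end IsCoord

end

section

/-! ### Hilbert functions and a form of Bézout's inequality -/

lemma _root_.Submodule.finrank_map_eq_of_ker_eq {K V W W' : Type*} [Field K] [AddCommGroup V]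
    [Module K V] [AddCommGroup W] [Module K W] [AddCommGroup W'] [Module K W'] (p : Submodule K V)
    (f : V →ₗ[K] W) (g : V →ₗ[K] W') (h : ∀ v ∈ p, f v = 0 ↔ g v = 0) :
    Module.finrank K (p.map f) = Module.finrank K (p.map g) := by
  have hker : LinearMap.ker (f.domRestrict p) = LinearMap.ker (g.domRestrict p) := by
    ext ⟨v, hv⟩
    simpa using h v hv
  rw [← LinearMap.range_domRestrict, ← LinearMap.range_domRestrict,
    ← (f.domRestrict p).quotKerEquivRange.finrank_eq,
    ← (g.domRestrict p).quotKerEquivRange.finrank_eq, hker]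

lemma _root_.Submodule.finrank_map_mkQ_add {K V : Type*} [Field K] [AddCommGroup V] [Module K V]
    {U W : Submodule K V} (h : U ≤ W) [FiniteDimensional K W] :
    Module.finrank K (W.map U.mkQ) + Module.finrank K U = Module.finrank K W := by
  rw [← LinearMap.finrank_range_add_finrank_ker (U.mkQ.domRestrict W),
    LinearMap.range_domRestrict]
  congr 1
  rw [LinearMap.ker_domRestrict, Submodule.ker_mkQ]
  exact (Submodule.comapSubtypeEquivOfLe h).finrank_eq.symm

lemma _root_.MvPolynomial.isCoprime_ker_eval {σ K : Type*} [Field K] {p p' : σ → K} (h : p ≠ p') :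
    IsCoprime (RingHom.ker (eval p)) (RingHom.ker (eval p')) := by
  obtain ⟨i, hi⟩ := Function.ne_iff.1 h
  have hi' : p' i - p i ≠ 0 := sub_ne_zero.2 (Ne.symm hi)
  rw [Ideal.isCoprime_iff_exists]
  refine ⟨C (p' i - p i)⁻¹ * (MvPolynomial.X i - C (p i)), by simp [RingHom.mem_ker],
    - (C (p' i - p i)⁻¹ * (MvPolynomial.X i - C (p' i))), by simp [RingHom.mem_ker], ?_⟩
  rw [← sub_eq_add_neg, ← mul_sub, sub_sub_sub_cancel_left, ← C_sub, ← C_mul, inv_mul_cancel₀ hi',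
    C_1]

variable {K : Type*} [Field K] {n : ℕ} {X : ProjectiveCurve K n}

/-- The space of the functions `F / X_j ^ m`, for `F` a form of degree `m`. -/
def formSpace (x : Fin (n + 1) → X.functionField) (m : ℕ) : Submodule K X.functionField :=
  (homogeneousSubmodule (Fin (n + 1)) K m).map (aeval x).toLinearMap

instance (x : Fin (n + 1) → X.functionField) (m : ℕ) : FiniteDimensional K (formSpace x m) :=
  Module.Finite.iff_fg.2 ((homogeneousSubmodule_fg (Fin (n + 1)) K m).map _)

variable {d : ℕ} {j : Fin (n + 1)} {x : Fin (n + 1) → X.functionField}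

lemma mem_formSpace {F : MvPolynomial (Fin (n + 1)) K} {m : ℕ} (hF : F.IsHomogeneous m) :
    aeval x F ∈ formSpace x m := ⟨F, hF, rfl⟩

namespace IsCoord

variable (hx : X.IsCoord j x) (hd : X.HasDegree d)
include hx hd

lemma exists_finrank_formSpace : ∃ (c : ℤ) (M : ℕ), ∀ m ≥ M,
    (Module.finrank K (formSpace x m) : ℤ) = d * m + c := by
  obtain ⟨c, hc⟩ := hd
  obtain ⟨M, hM⟩ := Filter.eventually_atTop.1 hc
  refine ⟨c, M, fun m hm => ?_⟩
  rw [← hM m hm, formSpace]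
  congr 1
  refine Submodule.finrank_map_eq_of_ker_eq _ _ _ fun F hF => ?_
  exact (hx.aeval_eq_zero_iff hF).trans Ideal.Quotient.eq_zero_iff_mem.symm

variable {B : MvPolynomial (Fin (n + 1)) K} {e : ℕ} (hB : B.IsHomogeneous e) (hB0 : aeval x B ≠ 0)
include hB hB0

/-- Forms of large degree $m$ on the curve, modulo $B$ times the forms of degree $m-e$, have
dimension $(dm+c)-(d(m-e)+c)=de$. As `Λ` kills the relations of the curve and the multiples of `B`,
independence of the images under `Λ` implies independence in this quotient. -/
lemma card_le_of_linearIndependent {W ι : Type*} [AddCommGroup W] [Module K W] [Fintype ι]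
    (Λ : MvPolynomial (Fin (n + 1)) K →ₗ[K] W) (hΛ : ∀ F, aeval x F = 0 → Λ F = 0)
    (hΛB : ∀ G, Λ (B * G) = 0) (F : ι → MvPolynomial (Fin (n + 1)) K)
    (hF : LinearIndependent K fun i => Λ (F i)) : Fintype.card ι ≤ d * e := by
  obtain ⟨c, M, hM⟩ := hx.exists_finrank_formSpace hd
  -- Large enough for the Hilbert polynomial to be valid at both `m` and `m - e`, and for every `F
  -- i` to be homogenized in degree `m`.
  let m := M + e + ∑ i, (F i).totalDegree
  have hm (i) : (F i).totalDegree ≤ m :=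
    (Finset.single_le_sum (f := fun i => (F i).totalDegree) (fun _ _ => Nat.zero_le _)
      (Finset.mem_univ i)).trans (Nat.le_add_left _ _)
  choose G hG hGx _ using fun i => hx.exists_aeval_eq (F i) (hm i)
  have hGF (i) : Λ (G i) = Λ (F i) := by
    rw [← sub_eq_zero, ← map_sub]
    exact hΛ _ (by rw [map_sub, hGx, sub_self])
  have hme : m - e + e = m := Nat.sub_add_cancel (by omega)
  let U : Submodule K X.functionField :=
    (formSpace x (m - e)).map (LinearMap.mulLeft K (aeval x B))
  have hU : U ≤ formSpace x m := by
    rintro _ ⟨_, ⟨H, hH, rfl⟩, rfl⟩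
    refine ⟨B * H, ?_, map_mul (aeval x) _ _⟩
    exact (show e + (m - e) = m by omega) ▸ hB.mul hH
  have hUrank : Module.finrank K U = Module.finrank K (formSpace x (m - e)) :=
    (Submodule.equivMapOfInjective _ (fun _ _ h => mul_left_cancel₀ hB0 h) _).finrank_eq.symm
  have hli : LinearIndependent K fun i => U.mkQ (aeval x (G i)) := by
    rw [Fintype.linearIndependent_iff] at hF ⊢
    intro a ha
    refine hF a ?_
    have h1 : aeval x (∑ i, a i • G i) ∈ U := by
      rw [← Submodule.Quotient.mk_eq_zero, ← Submodule.mkQ_apply]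
      simpa using ha
    obtain ⟨_, ⟨H, hH, rfl⟩, hH'⟩ := h1
    have h2 : Λ (∑ i, a i • G i - B * H) = 0 := hΛ _ (by
      rw [map_sub, ← hH', map_mul]; exact sub_self _)
    rw [map_sub, hΛB, sub_zero, map_sum] at h2
    simpa [hGF] using h2
  have hle : Fintype.card ι ≤ Module.finrank K ((formSpace x m).map U.mkQ) := by
    rw [← finrank_span_eq_card hli]
    refine Submodule.finrank_mono (Submodule.span_le.2 ?_)
    rintro _ ⟨i, rfl⟩
    exact ⟨_, mem_formSpace (hG i), rfl⟩
  have h3 := Submodule.finrank_map_mkQ_add hU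
  have h4 := hM m (by omega)
  have h5 := hM (m - e) (by omega)
  rw [hUrank] at h3
  have h6 : (m : ℤ) = ((m - e : ℕ) : ℤ) + e := by exact_mod_cast hme.symm
  have h7 : ((Module.finrank K ((formSpace x m).map U.mkQ) : ℕ) : ℤ) = d * e := by
    have : ((Module.finrank K ((formSpace x m).map U.mkQ) : ℕ) : ℤ) +
      Module.finrank K (formSpace x (m - e)) = Module.finrank K (formSpace x m) := by
      exact_mod_cast h3
    rw [h4, h5, h6] at this
    linarith
  have h8 : Module.finrank K ((formSpace x m).map U.mkQ) = d * e := by exact_mod_cast h7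
  omega

/-- Bézout's inequality: conditions imposed on the hypersurface `B` by pairwise coprime ideals. -/
lemma sum_le_of_isCoprime {ι : Type*} [Fintype ι] (J : ι → Ideal (MvPolynomial (Fin (n + 1)) K))
    (hJ : Pairwise (Function.onFun IsCoprime J)) (hJx : ∀ a F, aeval x F = 0 → F ∈ J a)
    (hBJ : ∀ a, B ∈ J a) (N : ι → ℕ) (v : ∀ a, Fin (N a) → MvPolynomial (Fin (n + 1)) K)
    (hv : ∀ a, LinearIndependent K fun k => Ideal.Quotient.mk (J a) (v a k)) :
    ∑ a, N a ≤ d * e := by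
  classical
  let Λ : MvPolynomial (Fin (n + 1)) K →ₗ[K] ∀ a, MvPolynomial (Fin (n + 1)) K ⧸ J a :=
    LinearMap.pi fun a => (Ideal.Quotient.mkₐ K (J a)).toLinearMap
  have hli := Pi.linearIndependent_single
    (fun a k => (Ideal.Quotient.mk (J a) (v a k) : MvPolynomial (Fin (n + 1)) K ⧸ J a)) hv
  -- The Chinese remainder theorem realizes all the local vectors by polynomials.
  choose F hF using fun ak : Σ a, Fin (N a) => Ideal.pi_quotient_surjective hJ
    (Pi.single ak.1 (Ideal.Quotient.mk (J ak.1) (v ak.1 ak.2)))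
  have := hx.card_le_of_linearIndependent hd hB hB0 Λ
    (fun F h => funext fun a => Ideal.Quotient.eq_zero_iff_mem.2 (hJx a F h))
    (fun G => funext fun a => Ideal.Quotient.eq_zero_iff_mem.2 (Ideal.mul_mem_right _ _ (hBJ a)))
    F (by
      have hΛF : (fun ak => Λ (F ak)) = fun ak : Σ a, Fin (N a) =>
        Pi.single ak.1 (Ideal.Quotient.mk (J ak.1) (v ak.1 ak.2)) :=
        funext fun ak => funext fun a => hF ak a
      rw [hΛF]
      exact hli)
  simpa using this

omit hx hd hB hB0 in
lemma eq_of_coord_eq {P Q : X.points} (hP : P.1.rep j ≠ 0) (hQ : Q.1.rep j ≠ 0)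
    (h : ∀ i, P.1.rep i / P.1.rep j = Q.1.rep i / Q.1.rep j) : P = Q := by
  apply Subtype.ext
  rw [← P.1.mk_rep, ← Q.1.mk_rep, Projectivization.mk_eq_mk_iff']
  refine ⟨P.1.rep j / Q.1.rep j, ?_⟩
  ext i
  have := h i
  rw [div_eq_div_iff hP hQ] at this
  rw [Pi.smul_apply, smul_eq_mul, div_mul_eq_mul_div, div_eq_iff hQ, this, mul_comm]

/-- Otherwise the maximal ideals of $de+1$ distinct zeros, each contributing one condition, would
violate Bézout's inequality. -/
lemma finite_zeros : {P : X.points | P.1.rep j ≠ 0 ∧ eval P.1.rep B = 0}.Finite := by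
  by_contra hinf
  obtain ⟨s, hs, hcard⟩ := Set.Infinite.exists_subset_card_eq hinf (d * e + 1)
  let p (P : s) (i : Fin (n + 1)) : K := P.1.1.rep i / P.1.1.rep j
  have hsj (P : s) : P.1.1.rep j ≠ 0 := (hs P.2).1
  have := hx.sum_le_of_isCoprime hd hB hB0 (fun P : s => RingHom.ker (eval (p P)))
    (fun P Q hPQ => isCoprime_ker_eval fun h => hPQ (Subtype.ext
      (eq_of_coord_eq (hsj P) (hsj Q) (congrFun h))))
    (fun P F hF => by
      rw [RingHom.mem_ker, ← hx.valueAt_aeval (hsj P), hF, valueAt_zero])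
    (fun P => by
      have h1 : p P = fun i => (P.1.1.rep j)⁻¹ * P.1.1.rep i :=
        funext fun i => div_eq_inv_mul _ _
      have h2 := hB.aeval_mul_left (P.1.1.rep j)⁻¹ P.1.1.rep
      rw [RingHom.mem_ker, h1]
      refine h2.trans ?_
      have h3 : aeval P.1.1.rep B = 0 := (hs P.2).2
      rw [h3, mul_zero]) (fun _ => 1) (fun _ _ => 1)
    (fun P => by
      rw [linearIndependent_unique_iff, map_one]
      have : RingHom.ker (eval (p P)) ≠ ⊤ := RingHom.ker_ne_top _
      exact fun h => this ((Ideal.eq_top_iff_one _).2 (by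
        rwa [← map_one (Ideal.Quotient.mk _), Ideal.Quotient.eq_zero_iff_mem] at h)))
  simp [hcard] at this

end IsCoord

lemma exists_rep_ne_zero (P : X.points) : ∃ j, P.1.rep j ≠ 0 :=
  Function.ne_iff.1 P.1.rep_nonzero

lemma finite_zeros_form (hd : X.HasDegree d) {B : MvPolynomial (Fin (n + 1)) K} {e : ℕ}
    (hB : B.IsHomogeneous e) (hB0 : X.toCone B ≠ 0) :
    {P : X.points | eval P.1.rep B = 0}.Finite := by
  have : {P : X.points | eval P.1.rep B = 0} ⊆
      ⋃ j, {P : X.points | P.1.rep j ≠ 0 ∧ eval P.1.rep B = 0} := fun P hP => by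
    obtain ⟨j, hj⟩ := exists_rep_ne_zero P
    exact Set.mem_iUnion.2 ⟨j, hj, hP⟩
  refine (Set.finite_iUnion fun j => ?_).subset this
  by_cases hj : X.toCone (MvPolynomial.X j) = 0
  · refine Set.finite_empty.subset fun P hP => hP.1 ?_
    simpa using P.2 _ ((X.toCone_eq_zero_iff _).1 hj)
  · obtain ⟨x, hx⟩ := exists_isCoord hj
    exact hx.finite_zeros hd hB (by rwa [Ne, hx.aeval_eq_zero_iff hB, ← toCone_eq_zero_iff])

lemma IsCoord.finite_rep_eq_zero (hx : X.IsCoord j x) (hd : X.HasDegree d) :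
    {P : X.points | P.1.rep j = 0}.Finite := by
  simpa using finite_zeros_form hd (isHomogeneous_X K j) hx.ne_zero

lemma finite_notMem_regularAt (hd : X.HasDegree d) (y : X.functionField) :
    {P : X.points | y ∉ X.regularAt P}.Finite := by
  obtain ⟨m, f, g, hf, hg, h0, h⟩ := y.2
  refine (finite_zeros_form hd hg h0).subset fun P hP => ?_
  by_contra h'
  exact hP ⟨m, f, g, hf, hg, h', h⟩

lemma finite_valueAt_eq_zero (hd : X.HasDegree d) {y : X.functionField} (hy : y ≠ 0) :
    {P : X.points | X.valueAt P y = 0}.Finite := by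
  refine ((finite_notMem_regularAt hd y).union (finite_notMem_regularAt hd y⁻¹)).subset
    fun P hP => ?_
  by_contra h
  simp only [Set.mem_union, Set.mem_ofPred_eq, not_or, not_not] at h
  have := valueAt_mul h.1 h.2
  rw [mul_inv_cancel₀ hy, valueAt_one, hP.out, zero_mul] at this
  exact one_ne_zero this

end

section

/-! ### Hasse derivatives -/

namespace IsHasseDerivative

variable {K L : Type*} [Field K] [Field L] [Algebra K L] {t : L} {D : ℕ → L →ₗ[K] L}
  (hD : IsHasseDerivative t D)
include hD

lemma leibniz_range (k : ℕ) (f g : L) :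
    D k (f * g) = ∑ i ∈ Finset.range (k + 1), D i f * D (k - i) g := by
  rw [hD.leibniz]
  exact Finset.Nat.sum_antidiagonal_eq_sum_range_succ (fun i j => D i f * D j g) k

lemma map_one {k : ℕ} (hk : k ≠ 0) : D k 1 = 0 := by
  induction k using Nat.strong_induction_on with
  | _ k ih =>
    obtain ⟨m, rfl⟩ := Nat.exists_eq_succ_of_ne_zero hk
    have h := hD.leibniz_range (m + 1) 1 1
    rw [Finset.sum_range_succ, Finset.sum_range_succ', Finset.sum_eq_zero, mul_one] at h
    · simpa [hD.zero] using h
    · intro i hi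
      rw [ih (i + 1) (by simpa using Finset.mem_range.1 hi) (by omega), zero_mul]

lemma map_algebraMap {k : ℕ} (hk : k ≠ 0) (c : K) : D k (algebraMap K L c) = 0 := by
  rw [Algebra.algebraMap_eq_smul_one, map_smul, hD.map_one hk, smul_zero]

lemma one_mul' (f g : L) : D 1 (f * g) = f * D 1 g + D 1 f * g := by
  rw [hD.leibniz_range, Finset.sum_range_succ, Finset.sum_range_one]
  simp [hD.zero]

lemma one_pow (f : L) (m : ℕ) : D 1 (f ^ m) = m * f ^ (m - 1) * D 1 f := by
  induction m with
  | zero => simp [hD.map_one one_ne_zero]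
  | succ m ih =>
    rw [pow_succ, hD.one_mul', ih]
    cases m with
    | zero => simp
    | succ m => push_cast; ring

end IsHasseDerivative

variable {K : Type*} [Field K] {n : ℕ} {X : ProjectiveCurve K n}

/-- The maps `D 0, …, D N` preserve the local ring at `P`. -/
def PreservesRegular (D : ℕ → X.functionField →ₗ[K] X.functionField) (N : ℕ) (P : X.points) :
    Prop := ∀ k ≤ N, ∀ y ∈ X.regularAt P, D k y ∈ X.regularAt P

variable {P : X.points} {t : X.functionField} {D : ℕ → X.functionField →ₗ[K] X.functionField}
  {N : ℕ} {j : Fin (n + 1)} {x : Fin (n + 1) → X.functionField}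

lemma IsCoord.exists_eq_div_of_mem_regularAt (hx : X.IsCoord j x) (hP : P.1.rep j ≠ 0)
    {y : X.functionField} (hy : y ∈ X.regularAt P) :
    ∃ f g : MvPolynomial (Fin (n + 1)) K, X.valueAt P (aeval x g) ≠ 0 ∧
      y = aeval x f / aeval x g := by
  obtain ⟨m, f, g, hf, hg, h0, h⟩ := hy
  refine ⟨f, g, ?_, Subtype.ext ?_⟩
  · have h1 : (fun i => P.1.rep i / P.1.rep j) = fun i => (P.1.rep j)⁻¹ * P.1.rep i :=
      funext fun i => div_eq_inv_mul _ _
    rw [hx.valueAt_aeval hP, h1, ← coe_aeval_eq_eval, RingHom.coe_coe, hg.aeval_mul_left]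
    exact mul_ne_zero (pow_ne_zero _ (inv_ne_zero hP)) h0
  · refine Eq.trans h (Eq.symm ?_)
    change ((aeval x f : X.functionField) : X.ConeField) / ((aeval x g : X.functionField) : _) = _
    rw [hx.coe_aeval hf, hx.coe_aeval hg, div_div_div_cancel_right₀ (pow_ne_zero _ hx.ne_zero)]

/-- By Leibniz, the functions with regular derivatives form an algebra, which contains the
polynomials in the coordinates. For a quotient $y=f/g$, expanding $D^{(k)}(yg)$ expresses $D^{(k)}y$
through lower derivatives of $y$, with denominator $g$. -/
lemma IsHasseDerivative.preservesRegular (hD : IsHasseDerivative t D) (hx : X.IsCoord j x)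
    (hP : P.1.rep j ≠ 0) (h : ∀ k ≤ N, ∀ i, D k (x i) ∈ X.regularAt P) :
    PreservesRegular D N P := by
  let S : Subalgebra K X.functionField :=
    { carrier := {y | ∀ k ≤ N, D k y ∈ X.regularAt P}
      mul_mem' := fun {y z} hy hz k hk => by
        rw [hD.leibniz_range]
        refine Subalgebra.sum_mem _ fun i hi => Subalgebra.mul_mem _ (hy _ ?_) (hz _ (by omega))
        have := Finset.mem_range.1 hi
        omega
      add_mem' := fun {y z} hy hz k hk => by
        rw [map_add]; exact Subalgebra.add_mem _ (hy k hk) (hz k hk)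
      algebraMap_mem' := fun c k hk => by
        by_cases hk0 : k = 0
        · subst hk0; rw [hD.zero]; exact Subalgebra.algebraMap_mem _ _
        · rw [hD.map_algebraMap hk0]; exact Subalgebra.zero_mem _ }
  have hS (F : MvPolynomial (Fin (n + 1)) K) : aeval x F ∈ S := by
    rw [aeval_def, eval₂_eq]
    exact Subalgebra.sum_mem _ fun s _ => Subalgebra.mul_mem _ (Subalgebra.algebraMap_mem _ _)
      (Subalgebra.prod_mem _ fun i _ => Subalgebra.pow_mem _ (show x i ∈ S from fun k hk => h k hk i) _)
  intro k hk y hy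
  obtain ⟨f, g, hg, hyfg⟩ := hx.exists_eq_div_of_mem_regularAt hP hy
  have hg0 : aeval x g ≠ 0 := fun h0 => hg (by rw [h0, valueAt_zero])
  have hfy : aeval x f = y * aeval x g := by rw [hyfg, div_mul_cancel₀ _ hg0]
  induction k using Nat.strong_induction_on with
  | _ k ih =>
    have h1 := hD.leibniz_range k y (aeval x g)
    rw [← hfy, Finset.sum_range_succ, Nat.sub_self, hD.zero] at h1
    have h2 : D k y = (D k (aeval x f) -
        ∑ i ∈ Finset.range k, D i y * D (k - i) (aeval x g)) * (aeval x g)⁻¹ := by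
      rw [h1, add_sub_cancel_left, mul_assoc, mul_inv_cancel₀ hg0, mul_one]
    rw [h2]
    refine Subalgebra.mul_mem _ (Subalgebra.sub_mem _ (hS f k hk) (Subalgebra.sum_mem _
      fun i hi => Subalgebra.mul_mem _ ?_ (hS g _ (by omega))))
      (inv_mem_regularAt (hx.aeval_mem_regularAt hP g) hg)
    have := Finset.mem_range.1 hi
    exact ih i this (by omega)

namespace IsHasseDerivative

variable (hD : IsHasseDerivative t D) (hreg : PreservesRegular D N P) {y z : X.functionField}
include hD hreg

lemma valueAt_map_mul (hy : y ∈ X.regularAt P) (hz : z ∈ X.regularAt P) {k : ℕ} (hk : k ≤ N) :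
    X.valueAt P (D k (y * z)) =
      ∑ i ∈ Finset.range (k + 1), X.valueAt P (D i y) * X.valueAt P (D (k - i) z) := by
  have hi' {i} (hi : i ∈ Finset.range (k + 1)) : i ≤ N := by
    have := Finset.mem_range.1 hi; omega
  rw [hD.leibniz_range, valueAt_sum]
  · exact Finset.sum_congr rfl fun i hi =>
      valueAt_mul (hreg _ (hi' hi) _ hy) (hreg _ (by omega) _ hz)
  · exact fun i hi => Subalgebra.mul_mem _ (hreg _ (hi' hi) _ hy) (hreg _ (by omega) _ hz)

lemma valueAt_map_mul_eq_zero {e f : ℕ} (hy : y ∈ X.regularAt P) (hz : z ∈ X.regularAt P)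
    (hye : ∀ k < e, X.valueAt P (D k y) = 0) (hzf : ∀ k < f, X.valueAt P (D k z) = 0) {k : ℕ}
    (hk : k < e + f) (hkN : k ≤ N) : X.valueAt P (D k (y * z)) = 0 := by
  rw [hD.valueAt_map_mul hreg hy hz hkN]
  refine Finset.sum_eq_zero fun i hik => ?_
  by_cases hi : i < e
  · rw [hye i hi, zero_mul]
  · rw [hzf _ (by have := Finset.mem_range.1 hik; omega), mul_zero]

lemma valueAt_map_mul_eq_mul {e f : ℕ} (hy : y ∈ X.regularAt P) (hz : z ∈ X.regularAt P)
    (hye : ∀ k < e, X.valueAt P (D k y) = 0) (hzf : ∀ k < f, X.valueAt P (D k z) = 0)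
    (hef : e + f ≤ N) :
    X.valueAt P (D (e + f) (y * z)) = X.valueAt P (D e y) * X.valueAt P (D f z) := by
  rw [hD.valueAt_map_mul hreg hy hz hef, Finset.sum_eq_single e]
  · rw [Nat.add_sub_cancel_left]
  · intro i hi hie
    by_cases h : i < e
    · rw [hye i h, zero_mul]
    · rw [hzf _ (by have := Finset.mem_range.1 hi; omega), mul_zero]
  · intro h
    exact absurd (Finset.mem_range.2 (by omega)) h

lemma valueAt_map_pow (hy : y ∈ X.regularAt P) (h0 : X.valueAt P y = 0) {k : ℕ} (hk : k ≤ N) :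
    (∀ i < k, X.valueAt P (D i (y ^ k)) = 0) ∧
      X.valueAt P (D k (y ^ k)) = X.valueAt P (D 1 y) ^ k := by
  have hy1 : ∀ i < 1, X.valueAt P (D i y) = 0 := fun i hi => by
    rw [Nat.lt_one_iff.1 hi, hD.zero, h0]
  induction k with
  | zero => simp [hD.zero]
  | succ k ih =>
    obtain ⟨h1, h2⟩ := ih (by omega)
    have hyk := Subalgebra.pow_mem _ hy k
    rw [pow_succ, pow_succ, ← h2]
    exact ⟨fun i hi => hD.valueAt_map_mul_eq_zero hreg hyk hy h1 hy1 hi (by omega),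
      hD.valueAt_map_mul_eq_mul hreg hyk hy h1 hy1 hk⟩

end IsHasseDerivative

/-! ### Intersection multiplicities with hyperplanes -/

lemma localRing_le (P : X.points) {y : X.ConeField} (hy : y ∈ X.localRing P) :
    y ∈ X.functionField := by
  obtain ⟨m, f, g, hf, hg, h0, h⟩ := hy
  exact ⟨m, f, g, hf, hg, X.toCone_ne_zero P h0, h⟩

/-- The ring of functions regular at `P`, as a subring of the function field, is the local ring. -/
def regularAtEquiv (P : X.points) : X.regularAt P ≃+* X.localRing P where
  toFun y := ⟨(y : X.functionField), y.2⟩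
  invFun y := ⟨⟨y, localRing_le P y.2⟩, y.2⟩
  left_inv _ := rfl
  right_inv _ := rfl
  map_mul' _ _ := rfl
  map_add' _ _ := rfl

lemma isUnit_regularAt_iff {y : X.regularAt P} : IsUnit y ↔ X.valueAt P y ≠ 0 := by
  constructor
  · exact fun h => (h.map (evalAt P)).ne_zero
  · intro h
    have hy0 : (y : X.functionField) ≠ 0 := fun h0 => h (by rw [h0, valueAt_zero])
    exact IsUnit.of_mul_eq_one ⟨_, inv_mem_regularAt y.2 h⟩ (Subtype.ext (mul_inv_cancel₀ hy0))

/-- With $y=u^e v$, where $u$ is a uniformizer and $v$ a unit, the Leibniz rule shows that the first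
nonzero derivative at $P$ is $D^{(e)}y(P)=(D^{(1)}u(P))^e\,v(P)$. -/
lemma IsHasseDerivative.valueAt_of_ord (hD : IsHasseDerivative t D)
    (hreg : PreservesRegular D N P) (hN : 1 ≤ N) (ht : t ∈ X.regularAt P) (hP : X.IsNonsingular P)
    {y : X.regularAt P} {e : ℕ} (he : e ≤ N)
    (hord : Ring.ord (X.localRing P) (regularAtEquiv P y) = e) :
    (∀ k < e, X.valueAt P (D k y) = 0) ∧ X.valueAt P (D e y) ≠ 0 := by
  have : IsDiscreteValuationRing (X.localRing P) := hP
  obtain ⟨u', hu⟩ := IsDiscreteValuationRing.exists_irreducible (X.localRing P)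
  obtain ⟨u, rfl⟩ := (regularAtEquiv P).surjective u'
  have hu0 : X.valueAt P u = 0 := by
    by_contra h
    exact hu.not_isUnit ((isUnit_regularAt_iff.2 h).map (regularAtEquiv P))
  -- The function $t-t(P)$ vanishes at $P$, so it equals $uz$; applying $D^{(1)}$ at $P$ gives
  -- $1=D^{(1)}u(P)\,z(P)$.
  have hu1 : X.valueAt P (D 1 u) ≠ 0 := by
    let s : X.regularAt P := ⟨t, ht⟩ - algebraMap K _ (X.valueAt P t)
    have hs0 : X.valueAt P s = 0 := by
      rw [← evalAt_apply, map_sub, AlgHom.commutes, evalAt_apply]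
      exact sub_self _
    have h1 : regularAtEquiv P s ∈ IsLocalRing.maximalIdeal (X.localRing P) := by
      rw [IsLocalRing.mem_maximalIdeal, mem_nonunits_iff, MulEquiv.isUnit_map,
        isUnit_regularAt_iff, not_not, hs0]
    rw [hu.maximalIdeal_eq, Ideal.mem_span_singleton] at h1
    obtain ⟨z', hz⟩ := h1
    obtain ⟨z, rfl⟩ := (regularAtEquiv P).surjective z'
    rw [← map_mul, EmbeddingLike.apply_eq_iff_eq] at hz
    have h2 : t - algebraMap K _ (X.valueAt P t) = u * z := congrArg Subtype.val hz
    have h3 := hD.valueAt_map_mul hreg u.2 z.2 hN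
    rw [← h2, map_sub, hD.one_self, hD.map_algebraMap one_ne_zero, sub_zero, valueAt_one,
      Finset.sum_range_succ, Finset.sum_range_one, hD.zero, hu0, zero_mul, zero_add] at h3
    intro h0
    rw [h0, zero_mul] at h3
    exact one_ne_zero h3
  have hy0 : regularAtEquiv P y ≠ 0 := by
    intro h
    rw [h, Ring.ord_eq_addVal, AddValuation.map_zero] at hord
    exact ENat.top_ne_natCast e hord
  obtain ⟨k, w, hw⟩ := IsDiscreteValuationRing.eq_unit_mul_pow_irreducible hy0 hu
  have hke : k = e := by
    have := IsDiscreteValuationRing.addVal_def _ w hu k hw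
    rw [← Ring.ord_eq_addVal, hord] at this
    exact_mod_cast this.symm
  subst hke
  obtain ⟨v, hv⟩ := (regularAtEquiv P).surjective w
  have hv0 : X.valueAt P v ≠ 0 := by
    rw [← isUnit_regularAt_iff, ← MulEquiv.isUnit_map (regularAtEquiv P), hv]
    exact w.isUnit
  rw [← hv, ← map_pow, ← map_mul, EmbeddingLike.apply_eq_iff_eq, mul_comm] at hw
  obtain ⟨h1, h2⟩ := hD.valueAt_map_pow hreg u.2 hu0 he
  have huk := Subalgebra.pow_mem _ u.2 k
  have hyw : (y : X.functionField) = u ^ k * v := congrArg Subtype.val hw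
  rw [hyw]
  refine ⟨fun i hi => hD.valueAt_map_mul_eq_zero (f := 0) hreg huk v.2 h1 (by simp) hi
    (by omega), ?_⟩
  have := hD.valueAt_map_mul_eq_mul (f := 0) hreg huk v.2 h1 (by simp) he
  rw [add_zero] at this
  rw [this, h2, hD.zero]
  exact mul_ne_zero (pow_ne_zero _ hu1) hv0

lemma isHomogeneous_linearForm (H : Projectivization K (Fin (n + 1) → K)) :
    (linearForm H).IsHomogeneous 1 :=
  IsHomogeneous.sum _ _ _ fun i _ => by
    simpa using (isHomogeneous_C (Fin (n + 1)) (H.rep i)).mul (isHomogeneous_X K i)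

lemma aeval_linearForm (H : Projectivization K (Fin (n + 1) → K)) :
    aeval x (linearForm H) = ∑ i, H.rep i • x i := by
  simp [linearForm, Algebra.smul_def]

lemma IsCoord.interMult_eq_ord (hx : X.IsCoord j x) (hP : P.1.rep j ≠ 0)
    (H : Projectivization K (Fin (n + 1) → K)) :
    X.interMult P H = Ring.ord (X.localRing P)
      (regularAtEquiv P ⟨aeval x (linearForm H), hx.aeval_mem_regularAt hP _⟩) := by
  have hc := hx.coe_aeval (isHomogeneous_linearForm H)
  rw [pow_one] at hc
  have : X.hyperplaneIdeal P H = Ideal.span {regularAtEquiv P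
      ⟨aeval x (linearForm H), hx.aeval_mem_regularAt hP _⟩} := by
    refine le_antisymm (Ideal.span_le.2 ?_) (Ideal.span_mono ?_)
    · rintro y ⟨j', hj', hy⟩
      refine Ideal.mem_span_singleton.2 ⟨⟨X.toCone (MvPolynomial.X j) / X.toCone
        (MvPolynomial.X j'), 1, _, _, isHomogeneous_X _ _, isHomogeneous_X _ _,
        by simpa using hj', rfl⟩, Subtype.ext ?_⟩
      refine hy.trans ?_
      change _ = ((aeval x (linearForm H) : X.functionField) : X.ConeField) * _
      rw [hc, div_mul_div_cancel₀ hx.ne_zero]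
    · rintro _ rfl
      exact ⟨j, hP, hc⟩
  rw [interMult, this]
  rfl

lemma IsHasseDerivative.valueAt_of_interMult (hD : IsHasseDerivative t D)
    (hreg : PreservesRegular D N P) (hN : 1 ≤ N) (ht : t ∈ X.regularAt P) (hP : X.IsNonsingular P)
    (hx : X.IsCoord j x) (hPj : P.1.rep j ≠ 0) {H : Projectivization K (Fin (n + 1) → K)}
    {e : ℕ} (he : e ≤ N) (hH : X.interMult P H = e) :
    (∀ k < e, H.rep ⬝ᵥ (fun i => X.valueAt P (D k (x i))) = 0) ∧
      H.rep ⬝ᵥ (fun i => X.valueAt P (D e (x i))) ≠ 0 := by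
  rw [hx.interMult_eq_ord hPj] at hH
  have h := hD.valueAt_of_ord hreg hN ht hP he hH
  have hk (k) (hk : k ≤ N) : X.valueAt P (D k (aeval x (linearForm H))) =
      H.rep ⬝ᵥ (fun i => X.valueAt P (D k (x i))) := by
    have hi (i) : D k (x i) ∈ X.regularAt P := hreg k hk _ (hx.mem_regularAt hPj i)
    rw [aeval_linearForm, map_sum, valueAt_sum]
    · exact Finset.sum_congr rfl fun i _ => by rw [map_smul, valueAt_smul _ (hi i)]
    · intro i _
      rw [map_smul]
      exact Subalgebra.smul_mem _ (hi i) _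
  exact ⟨fun k hke => by rw [← hk k (by omega)]; exact h.1 k hke, by rw [← hk e he]; exact h.2⟩

end

section

/-! ### Frobenius orders and osculating hyperplanes -/

/-- The matrix $AB^{T}$ is triangular with nonzero diagonal. -/
lemma _root_.Matrix.det_ne_zero_of_triangular_pairing {m R : Type*} [Fintype m] [LinearOrder m]
    [CommRing R] [IsDomain R] (A B : Matrix m m R) (h0 : ∀ l k, k < l → A l ⬝ᵥ B k = 0)
    (h1 : ∀ l, A l ⬝ᵥ B l ≠ 0) : A.det ≠ 0 ∧ B.det ≠ 0 := by
  have h : (A * B.transpose).det ≠ 0 := by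
    have ht : (A * B.transpose).IsUpperTriangular := fun l k hk => h0 l k hk
    rw [Matrix.det_of_isUpperTriangular ht]
    exact Finset.prod_ne_zero_iff.2 fun l _ => h1 l
  rw [Matrix.det_mul, Matrix.det_transpose] at h
  exact ⟨left_ne_zero_of_mul h, right_ne_zero_of_mul h⟩

/-- The zero block has $i+1$ rows and $n+1-i$ columns. These numbers add up to $n+2>n+1$, so every
permutation meets the block. -/
lemma _root_.Matrix.det_eq_zero_of_zero_block {n : ℕ} {R : Type*} [CommRing R]
    (C : Matrix (Fin (n + 1)) (Fin (n + 1)) R) (i : Fin n)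
    (h : ∀ j ≤ i, ∀ l ≥ i.castSucc, C j.succ l = 0) : C.det = 0 := by
  rw [Matrix.det_apply]
  refine Finset.sum_eq_zero fun σ _ => ?_
  obtain ⟨k, hk, hσ⟩ : ∃ k ≥ i.castSucc, σ k ∈ Finset.Icc 1 i.succ := by
    by_contra! hne
    have hsub : (Finset.Ici i.castSucc).map σ.toEmbedding ⊆ (Finset.Icc 1 i.succ)ᶜ := by
      intro r hr
      obtain ⟨k, hk, rfl⟩ := Finset.mem_map.1 hr
      exact Finset.mem_compl.2 (hne k (Finset.mem_Ici.1 hk))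
    have hcard := Finset.card_le_card hsub
    rw [Finset.card_map, Finset.card_compl, Fintype.card_fin, Fin.card_Ici, Fin.card_Icc] at hcard
    have := i.2
    have h1 : ((1 : Fin (n + 1)) : ℕ) = 1 := by
      rw [Fin.val_one', Nat.mod_eq_of_lt (by omega)]
    simp only [Fin.val_castSucc, Fin.val_succ, h1] at hcard
    omega
  obtain ⟨hσ1, hσ2⟩ := Finset.mem_Icc.1 hσ
  have hne : σ k ≠ 0 := by
    intro h0
    have := i.2
    have h1 : ((1 : Fin (n + 1)) : ℕ) = 1 := by
      rw [Fin.val_one', Nat.mod_eq_of_lt (by omega)]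
    rw [h0, Fin.le_def, h1] at hσ1
    simp at hσ1
  obtain ⟨r, hr⟩ := Fin.exists_succ_eq.2 hne
  rw [← hr, Fin.succ_le_succ_iff] at hσ2
  rw [Finset.prod_eq_zero (Finset.mem_univ k) (by rw [← hr]; exact h r hσ2 k hk), smul_zero]

variable {K : Type*} [Field K] {n : ℕ} {X : ProjectiveCurve K n}
variable {P : X.points} {t : X.functionField} {D : ℕ → X.functionField →ₗ[K] X.functionField}
  {d : ℕ} {j : Fin (n + 1)} {x : Fin (n + 1) → X.functionField} {ε : Fin (n + 1) → ℕ}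

lemma valueAt_det {m : Type*} [Fintype m] [DecidableEq m] (M : Matrix m m X.functionField)
    (hM : ∀ i k, M i k ∈ X.regularAt P) :
    X.valueAt P M.det = (M.map (X.valueAt P)).det := by
  let M' : Matrix m m (X.regularAt P) := Matrix.of fun i k => ⟨M i k, hM i k⟩
  have h1 : (X.regularAt P).val M'.det = M.det := by
    rw [AlgHom.map_det]; rfl
  have h2 : evalAt P M'.det = (M.map (X.valueAt P)).det := by
    rw [AlgHom.map_det]; rfl
  rw [← h1, ← h2]; rfl

/-- The vector of the values at `P` of the `k`-th derivatives of the coordinate functions. -/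
def derivVector (D : ℕ → X.functionField →ₗ[K] X.functionField)
    (x : Fin (n + 1) → X.functionField) (P : X.points) (k : ℕ) : Fin (n + 1) → K :=
  fun i => X.valueAt P (D k (x i))

/-- The conditions on a point, satisfied at all but finitely many points, under which the order
sequence and the derivations `D k` describe the intersection with hyperplanes. -/
structure IsGenericPoint (ε : Fin (n + 1) → ℕ) (j : Fin (n + 1)) (t : X.functionField)
    (D : ℕ → X.functionField →ₗ[K] X.functionField) (P : X.points) : Prop where
  rep_ne_zero : P.1.rep j ≠ 0
  isNonsingular : X.IsNonsingular P
  orders_eq : X.orders P = Set.range ε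
  mem_regularAt : t ∈ X.regularAt P
  preservesRegular : PreservesRegular D (ε (Fin.last n)) P

lemma finite_not_isGenericPoint (hd : X.HasDegree d) (hε : X.IsOrderSequence ε)
    (hD : IsHasseDerivative t D) (hx : X.IsCoord j x) :
    {P : X.points | ¬ IsGenericPoint ε j t D P}.Finite := by
  have h3 : (⋃ k ∈ Finset.range (ε (Fin.last n) + 1),
      ⋃ i, {P : X.points | D k (x i) ∉ X.regularAt P}).Finite :=
    Set.Finite.biUnion (Finset.finite_toSet _) fun k _ =>
      Set.finite_iUnion fun i => finite_notMem_regularAt hd _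
  refine (((hx.finite_rep_eq_zero hd).union hε.2).union
    ((finite_notMem_regularAt hd t).union h3)).subset fun P hP => ?_
  by_contra h
  simp only [Set.mem_union, Set.mem_ofPred_eq, Set.mem_iUnion, not_or, not_exists,
    not_not, Finset.mem_range] at h
  obtain ⟨⟨h1, h2, h3⟩, h4, h5⟩ := h
  exact hP ⟨h1, h2, h3, h4, hD.preservesRegular hx h1 fun k hk i => h5 k (by omega) i⟩

namespace IsGenericPoint

variable (hP : IsGenericPoint ε j t D P) (hε : X.IsOrderSequence ε) (hn : n ≠ 0)
  (hD : IsHasseDerivative t D) (hx : X.IsCoord j x)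
include hP hε hn hD hx

lemma dotProduct_derivVector {H : Projectivization K (Fin (n + 1) → K)} {l : Fin (n + 1)}
    (hH : X.interMult P H = ε l) : (∀ k < ε l, H.rep ⬝ᵥ derivVector D x P k = 0) ∧
      H.rep ⬝ᵥ derivVector D x P (ε l) ≠ 0 := by
  have h1 : ε 0 < ε (Fin.last n) := hε.1 (by rw [Fin.lt_def]; simpa using Nat.pos_of_ne_zero hn)
  exact hD.valueAt_of_interMult hP.preservesRegular (by omega) hP.mem_regularAt hP.isNonsingular
    hx hP.rep_ne_zero (hε.1.monotone (Fin.le_last l)) hH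

/-- The row `a l` consists of the coordinates of a hyperplane of multiplicity $\varepsilon_l$ at
$P$. Its pairing with the derivative vectors is triangular, so both families are bases. -/
lemma exists_dual : ∃ a : Matrix (Fin (n + 1)) (Fin (n + 1)) K, a.det ≠ 0 ∧
    (∀ l, ∀ k < ε l, a l ⬝ᵥ derivVector D x P k = 0) ∧
    (Matrix.of fun l => derivVector D x P (ε l)).det ≠ 0 := by
  have : ∀ l, ∃ H, X.interMult P H = ε l := fun l => by
    have : ε l ∈ X.orders P := by rw [hP.orders_eq]; exact ⟨l, rfl⟩
    exact this
  choose H hH using this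
  have h := fun l => hP.dotProduct_derivVector hε hn hD hx (hH l)
  obtain ⟨h1, h2⟩ := Matrix.det_ne_zero_of_triangular_pairing (Matrix.of fun l => (H l).rep)
    (Matrix.of fun l => derivVector D x P (ε l)) (fun l k hk => (h l).1 _ (hε.1 hk))
    (fun l => (h l).2)
  exact ⟨_, h1, fun l => (h l).1, h2⟩

omit hε hn hD hx in
lemma exists_osculating : ∃ H, X.interMult P H = ε (Fin.last n) := by
  have : ε (Fin.last n) ∈ X.orders P := by rw [hP.orders_eq]; exact ⟨_, rfl⟩
  exact this

/-- Subtracting the multiple of `H.rep` that matches `b` on the derivative of order $\varepsilon_n$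
leaves a vector orthogonal to a basis. -/
lemma eq_smul_of_dotProduct_eq_zero {H : Projectivization K (Fin (n + 1) → K)}
    (hH : X.interMult P H = ε (Fin.last n)) {b : Fin (n + 1) → K}
    (hb : ∀ l : Fin n, b ⬝ᵥ derivVector D x P (ε l.castSucc) = 0) :
    ∃ c : K, b = c • H.rep := by
  obtain ⟨h0, h1⟩ := hP.dotProduct_derivVector hε hn hD hx hH
  obtain ⟨_, _, _, hdet⟩ := hP.exists_dual hε hn hD hx
  refine ⟨(b ⬝ᵥ derivVector D x P (ε (Fin.last n))) /
    (H.rep ⬝ᵥ derivVector D x P (ε (Fin.last n))), ?_⟩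
  rw [← sub_eq_zero]
  refine Matrix.eq_zero_of_mulVec_eq_zero hdet (funext fun l => ?_)
  change derivVector D x P (ε l) ⬝ᵥ _ = 0
  rw [dotProduct_comm, sub_dotProduct, smul_dotProduct, smul_eq_mul]
  induction l using Fin.lastCases with
  | last => rw [div_mul_cancel₀ _ h1, sub_self]
  | cast l => rw [hb, h0 _ (hε.1 l.castSucc_lt_last), mul_zero, sub_zero]

end IsGenericPoint

/-- If the determinant were nonzero, minimality would give a first index $i$ with
$\nu_i<\varepsilon_i$ and $\nu_m=\varepsilon_m$ for $m<i$. At a general point the derivatives of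
orders $\nu_0,\dots,\nu_i$ would then be orthogonal to the hyperplanes of multiplicity at least
$\varepsilon_i$, forcing the determinant for $\nu$ to vanish. -/
lemma frobeniusDet_orders_eq_zero [Infinite X.points] (hd : X.HasDegree d)
    (hε : X.IsOrderSequence ε) (hn : n ≠ 0) (hD : IsHasseDerivative t D) (hx : X.IsCoord j x)
    {Q : ℕ} {ν : Fin n → ℕ}
    (hν : IsLeast {μ : Lex (Fin n → ℕ) | frobeniusDet D x Q (ofLex μ) ≠ 0} (toLex ν))
    (hνε : ν ≠ fun l => ε l.castSucc) : frobeniusDet D x Q (fun l => ε l.castSucc) = 0 := by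
  by_contra hne
  have hlt : toLex ν < toLex fun l : Fin n => ε l.castSucc :=
    lt_of_le_of_ne (hν.2 hne) fun h => hνε (toLex.injective h)
  obtain ⟨i, hi, hi'⟩ := hlt
  have hfin := ((finite_not_isGenericPoint hd hε hD hx).union
    (finite_valueAt_eq_zero hd hν.1)).union (Set.finite_iUnion fun k => Set.finite_iUnion fun i =>
      finite_notMem_regularAt hd (D (ν k) (x i)))
  obtain ⟨P, hP⟩ := hfin.infinite_compl.nonempty
  simp only [Set.mem_compl_iff, Set.mem_union, Set.mem_ofPred_eq, Set.mem_iUnion, not_or,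
    not_exists, not_not] at hP
  obtain ⟨⟨hP, h0⟩, hreg⟩ := hP
  obtain ⟨a, ha, ha', -⟩ := hP.exists_dual hε hn hD hx
  rw [frobeniusDet, valueAt_det] at h0
  · refine (mul_ne_zero h0 ha) ?_
    rw [← Matrix.det_transpose a, ← Matrix.det_mul]
    -- For $m\le i\le l$ one has $\nu_m<\varepsilon_l$, so these entries of the product with the
    -- transpose of `a` vanish.
    refine Matrix.det_eq_zero_of_zero_block _ i fun m hm l hl => ?_
    change derivVector D x P (ν m) ⬝ᵥ a l = 0
    rw [dotProduct_comm]
    refine ha' l _ (lt_of_lt_of_le ?_ (hε.1.monotone hl))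
    rcases hm.lt_or_eq with hm | rfl
    · exact (hi m hm).trans_lt (hε.1 (Fin.castSucc_lt_castSucc_iff.2 hm))
    · exact hi'
  · intro r c
    induction r using Fin.cases with
    | zero => exact Subalgebra.pow_mem _ (hx.mem_regularAt hP.rep_ne_zero c) _
    | succ r => exact hreg r c

/-- If the last Frobenius order is `ε_n`, the osculating hyperplane at a general point `P` contains
the image of `P` under the Frobenius map. -/
lemma IsGenericPoint.dotProduct_pow_eq_zero [Infinite X.points] (hd : X.HasDegree d)
    (hP : IsGenericPoint ε j t D P)
    (hε : X.IsOrderSequence ε) (hn : n ≠ 0) (hD : IsHasseDerivative t D) (hx : X.IsCoord j x)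
    {Q : ℕ} {ν : Fin n → ℕ}
    (hν : IsLeast {μ : Lex (Fin n → ℕ) | frobeniusDet D x Q (ofLex μ) ≠ 0} (toLex ν))
    (hνε : ν ≠ fun l => ε l.castSucc) {H : Projectivization K (Fin (n + 1) → K)}
    (hH : X.interMult P H = ε (Fin.last n)) : H.rep ⬝ᵥ (fun i => P.1.rep i ^ Q) = 0 := by
  have h0 := congrArg (X.valueAt P) (frobeniusDet_orders_eq_zero hd hε hn hD hx hν hνε)
  have hxr := hx.mem_regularAt hP.rep_ne_zero
  rw [frobeniusDet, valueAt_det, valueAt_zero] at h0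
  -- Rows $1,\dots,n$ identify the kernel vector with the osculating hyperplane; row $0$ then says
  -- that it contains the Frobenius image.
  · obtain ⟨b, hb0, hb⟩ := Matrix.exists_mulVec_eq_zero_iff.2 h0
    obtain ⟨c, rfl⟩ := hP.eq_smul_of_dotProduct_eq_zero hε hn hD hx hH (b := b) fun l => by
      rw [dotProduct_comm]
      exact congrFun hb l.succ
    have h1 : (fun i => X.valueAt P (x i ^ Q)) ⬝ᵥ (c • H.rep) = 0 := congrFun hb 0
    rw [dotProduct_smul, smul_eq_mul, mul_eq_zero,
      or_iff_right (fun hc => hb0 (by rw [hc, zero_smul])), dotProduct_comm] at h1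
    have h2 : (fun i => P.1.rep i ^ Q) =
        (P.1.rep j ^ Q) • fun i => X.valueAt P (x i ^ Q) := by
      ext i
      rw [Pi.smul_apply, smul_eq_mul, valueAt_pow (hxr i), hx.valueAt_eq hP.rep_ne_zero,
        ← mul_pow, mul_div_cancel₀ _ hP.rep_ne_zero]
    rw [h2, dotProduct_smul, h1, smul_zero]
  · intro r c
    induction r using Fin.cases with
    | zero => exact Subalgebra.pow_mem _ (hxr c) _
    | succ r => exact hP.preservesRegular _ (hε.1.monotone (Fin.le_last _)) _ (hxr c)

end

section

/-! ### Specialization of generic points -/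

/-- Over an algebraically closed field, finitely many elements of a field extension can be
specialized, the nonzero ones to nonzero values. -/
lemma _root_.IsAlgClosed.exists_specialization (K : Type*) {Ω : Type*} [Field K] [IsAlgClosed K]
    [Field Ω] [Algebra K Ω] {G : Set Ω} (hG : G.Finite) :
    ∃ (R : Subalgebra K Ω) (φ : R →ₐ[K] K), G ⊆ R ∧
      ∀ g : R, (g : Ω) ∈ G → (g : Ω) ≠ 0 → φ g ≠ 0 := by
  -- Adjoining the inverses makes the nonzero elements of `G` units, so no homomorphism to `K` kills
  -- them; one exists by Zariski's lemma.
  let R : Subalgebra K Ω := Algebra.adjoin K (G ∪ Inv.inv '' G)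
  have hfg : R.FG := Subalgebra.fg_def.2 ⟨_, hG.union (hG.image _), rfl⟩
  have : Algebra.FiniteType K R := R.fg_iff_finiteType.1 hfg
  obtain ⟨m, hm⟩ := Ideal.exists_maximal R
  let : Field (R ⧸ m) := Ideal.Quotient.field m
  have : Module.Finite K (R ⧸ m) := finite_of_finite_type_of_isJacobsonRing K (R ⧸ m)
  have hbij : Function.Bijective (Algebra.ofId K (R ⧸ m)) :=
    IsAlgClosed.algebraMap_bijective_of_isIntegral
  let φ : R →ₐ[K] K := (AlgEquiv.ofBijective _ hbij).symm.toAlgHom.comp (Ideal.Quotient.mkₐ K m)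
  refine ⟨R, φ, fun g hg => Algebra.subset_adjoin (Or.inl hg), fun g hg h0 hφ => ?_⟩
  let g' : R := ⟨(g : Ω)⁻¹, Algebra.subset_adjoin (Or.inr ⟨_, hg, rfl⟩)⟩
  have h1 : g * g' = 1 := Subtype.ext (mul_inv_cancel₀ h0)
  have h2 := congrArg φ h1
  rw [map_mul, hφ, zero_mul, map_one] at h2
  exact zero_ne_one h2

variable {K : Type*} [Field K] {n : ℕ} {X : ProjectiveCurve K n}
  {j : Fin (n + 1)} {x : Fin (n + 1) → X.functionField}

/-- A curve is not a point: some coordinate function is not constant. -/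
lemma IsCoord.exists_notMem_range (hx : X.IsCoord j x) :
    ∃ i, x i ∉ Set.range (algebraMap K X.functionField) := by
  by_contra! h
  choose c hc using h
  let mk : MvPolynomial (Fin (n + 1)) K →ₐ[K] X.CoordRing := Ideal.Quotient.mkₐ K X.ideal
  have hmk (i) : mk (MvPolynomial.X i) = mk (C (c i) * MvPolynomial.X j) := by
    refine Ideal.Quotient.eq.2 ((X.toCone_eq_zero_iff _).1 ?_)
    have h1 := hx.eq_div i
    rw [← hc, eq_div_iff hx.ne_zero] at h1
    rw [map_sub, map_mul, ← h1, sub_eq_zero]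
    exact congrArg (· * _) (X.toCone.commutes (c i)).symm
  have hcomp : (Polynomial.aeval (mk (MvPolynomial.X j))).comp
      (aeval fun i => c i • (Polynomial.X : Polynomial K)) = mk := by
    ext i
    rw [hmk i, map_mul, ← algebraMap_eq, AlgHom.commutes, ← Algebra.smul_def]
    simp
  -- With all coordinate functions constant, the cone would be a quotient of $K[T]$, of dimension at
  -- most $1$ instead of $2$.
  have hsurj : Function.Surjective (Polynomial.aeval (R := K) (mk (MvPolynomial.X j))) := by
    refine Function.Surjective.of_comp
      (g := (aeval fun i => c i • Polynomial.X :
        MvPolynomial (Fin (n + 1)) K →ₐ[K] Polynomial K)) ?_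
    rw [← AlgHom.coe_comp, hcomp]
    exact Ideal.Quotient.mkₐ_surjective K X.ideal
  have hle := ringKrullDim_le_of_surjective
    (Polynomial.aeval (R := K) (mk (MvPolynomial.X j))).toRingHom hsurj
  rw [X.dim_cone, Polynomial.ringKrullDim_of_isNoetherianRing, ringKrullDim_eq_zero_of_field,
    zero_add] at hle
  exact absurd hle (by decide)

/-- Finitely many generic points of the curve with coordinates in an extension field can be
specialized simultaneously to points outside a given finite set. -/
lemma IsCoord.exists_points [IsAlgClosed K] (hx : X.IsCoord j x) {Ω ι : Type*} [Field Ω]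
    [Algebra K Ω] [Finite ι] (σ : ι → X.functionField →ₐ[K] Ω) {G : Set Ω} (hG : G.Finite)
    {B : Set X.points} (hB : B.Finite) :
    ∃ (R : Subalgebra K Ω) (φ : R →ₐ[K] K) (p : ι → X.points), G ⊆ R ∧
      (∀ g : R, (g : Ω) ∈ G → (g : Ω) ≠ 0 → φ g ≠ 0) ∧ (∀ a i, σ a (x i) ∈ R) ∧
      ∀ a, p a ∉ B ∧ (p a).1.rep j ≠ 0 ∧ ∀ y ∈ X.regularAt (p a), ∀ h : σ a y ∈ R,
        X.valueAt (p a) y = φ ⟨σ a y, h⟩ := by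
  obtain ⟨i₀, hi₀⟩ := hx.exists_notMem_range
  let G₁ : Set Ω := Set.range fun ai : ι × Fin (n + 1) => σ ai.1 (x ai.2)
  -- These elements are nonzero because `x i₀` is not constant. Keeping them nonzero prevents the
  -- specialized points from lying in `B`.
  let G₂ : Set Ω := ⋃ a, (fun P : X.points =>
    σ a (x i₀ - algebraMap K _ (P.1.rep i₀ / P.1.rep j))) '' B
  have hfin : (G ∪ (G₁ ∪ G₂)).Finite :=
    hG.union ((Set.finite_range _).union (Set.finite_iUnion fun a => hB.image _))
  obtain ⟨R, φ, hR, hφ⟩ := IsAlgClosed.exists_specialization K hfin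
  have hxR (a i) : σ a (x i) ∈ R := hR (Or.inr (Or.inl ⟨(a, i), rfl⟩))
  let ψ (a : ι) : MvPolynomial (Fin (n + 1)) K →ₐ[K] R := aeval fun i => ⟨σ a (x i), hxR a i⟩
  have hψ (a F) : (ψ a F : Ω) = σ a (aeval x F) := by
    have : R.val.comp (ψ a) = (σ a).comp (aeval x) := by ext i; simp [ψ]
    exact DFunLike.congr_fun this F
  let q (a : ι) (i : Fin (n + 1)) : K := φ ⟨σ a (x i), hxR a i⟩
  have hq (a F) : φ (ψ a F) = eval (q a) F := by
    have : φ.comp (ψ a) = aeval (q a) := by ext i; simp [ψ, q]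
    exact DFunLike.congr_fun this F
  have hqj (a) : q a j = 1 := by
    have : (⟨σ a (x j), hxR a j⟩ : R) = 1 := Subtype.ext (by simp [hx.self])
    simp only [q, this, map_one]
  choose p hpj hpq using fun a => hx.exists_point (q a) (hqj a) fun F hF => by
    have : ψ a F = 0 := Subtype.ext (by rw [hψ, hF, map_zero]; rfl)
    rw [← hq, this, map_zero]
  refine ⟨R, φ, p, fun g hg => hR (Or.inl hg), fun g hg => hφ g (Or.inl hg), hxR,
    fun a => ⟨fun hpB => ?_, hpj a, fun y hy h => ?_⟩⟩
  · have hmem : σ a (x i₀ - algebraMap K _ ((p a).1.rep i₀ / (p a).1.rep j)) ∈ G₂ :=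
      Set.mem_iUnion.2 ⟨a, p a, hpB, rfl⟩
    refine hφ ⟨_, hR (Or.inr (Or.inr hmem))⟩ (Or.inr (Or.inr hmem)) ?_ ?_
    · rw [Ne, map_eq_zero, sub_eq_zero]
      exact fun h => hi₀ ⟨_, h.symm⟩
    · have : (⟨_, hR (Or.inr (Or.inr hmem))⟩ : R) =
          ⟨σ a (x i₀), hxR a i₀⟩ - algebraMap K R ((p a).1.rep i₀ / (p a).1.rep j) :=
        Subtype.ext
          ((map_sub (σ a) _ _).trans (congrArg _ ((σ a).commutes _)))
      rw [this, map_sub, AlgHom.commutes, hpq]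
      exact sub_self _
  · obtain ⟨f, g, hg, hyfg⟩ := hx.exists_eq_div_of_mem_regularAt (hpj a) hy
    have hg0 : aeval x g ≠ 0 := fun h0 => hg (by rw [h0, valueAt_zero])
    have hval (F) : X.valueAt (p a) (aeval x F) = φ (ψ a F) := by
      rw [hx.valueAt_aeval (hpj a), hq]
      congr 2
      exact funext (hpq a)
    have h1 : y * aeval x g = aeval x f := by rw [hyfg, div_mul_cancel₀ _ hg0]
    have h2 : (⟨σ a y, h⟩ : R) * ψ a g = ψ a f := by
      apply Subtype.ext
      rw [MulMemClass.coe_mul, hψ, hψ, ← h1, map_mul]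
    have h3 := valueAt_mul hy (hx.aeval_mem_regularAt (hpj a) g)
    rw [h1, hval, hval, ← h2, map_mul] at h3
    rw [hval] at hg
    exact (mul_right_cancel₀ hg h3).symm

/-- Were the set of points finite, the generic point could be specialized outside all of it. -/
lemma IsCoord.infinite_points [IsAlgClosed K] (hx : X.IsCoord j x) : Infinite X.points := by
  refine Set.infinite_univ_iff.1 fun h => ?_
  obtain ⟨_, _, p, -, -, -, hp⟩ := hx.exists_points
    (fun _ : Unit => AlgHom.id K X.functionField) Set.finite_empty h
  exact (hp ()).1 trivial

end

section

/-! ### The function field and the field of the dual curve -/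

lemma _root_.Transcendental.linearIndependent_pow {R A : Type*} [CommRing R] [CommRing A]
    [Algebra R A] {a : A} (h : Transcendental R a) : LinearIndependent R fun i : ℕ => a ^ i := by
  have h1 := (Polynomial.basisMonomials R).linearIndependent.map'
    (Polynomial.aeval a).toLinearMap
    (LinearMap.ker_eq_bot.2 (transcendental_iff_injective.1 h))
  have h2 : (Polynomial.aeval a).toLinearMap ∘ Polynomial.basisMonomials R = fun i => a ^ i := by
    ext i; simp [Polynomial.aeval_monomial]
  rwa [h2] at h1

lemma _root_.Transcendental.linearIndependent_pow_mul_pow {K S L : Type*} [Field K] [Field S]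
    [Field L] [Algebra K S] [Algebra S L] [Algebra K L] [IsScalarTower K S L] {f : S} {y : L}
    (hf : Transcendental K (algebraMap S L f)) (hy : Transcendental S y) (N : ℕ) :
    LinearIndependent K fun p : Fin N × Fin N => algebraMap S L f ^ (p.1 : ℕ) * y ^ (p.2 : ℕ) := by
  have hf' : Transcendental K f := fun h => hf h.algebraMap
  have h1 : LinearIndependent K fun i : Fin N => f ^ (i : ℕ) :=
    hf'.linearIndependent_pow.comp _ Fin.val_injective
  have h2 : LinearIndependent S fun i : Fin N => y ^ (i : ℕ) :=
    hy.linearIndependent_pow.comp _ Fin.val_injective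
  have h3 := linearIndependent_smul h1 h2
  simpa only [Algebra.smul_def, map_pow] using h3

lemma _root_.IsAlgClosed.transcendental_of_notMem_range {K L : Type*} [Field K] [IsAlgClosed K]
    [Field L] [Algebra K L] {y : L} (hy : y ∉ Set.range (algebraMap K L)) : Transcendental K y :=
  fun h => hy (minpoly.mem_range_of_degree_eq_one K y
    (IsAlgClosed.degree_eq_one_of_irreducible K (minpoly.irreducible h.isIntegral)))

variable {K : Type*} [Field K] {n : ℕ} {X : ProjectiveCurve K n}
variable {P : X.points} {t : X.functionField} {D : ℕ → X.functionField →ₗ[K] X.functionField}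
  {d : ℕ} {j : Fin (n + 1)} {x : Fin (n + 1) → X.functionField} {ε : Fin (n + 1) → ℕ}

/-- If $y$ were transcendental over $M$, the $(N+1)^2$ monomials $f^iy^k$ with $i,k\le N$ would be
independent over $K$. After clearing denominators they lie in a space of forms of degree $2Ns$,
whose dimension is only linear in $N$. -/
lemma IsCoord.isAlgebraic (hx : X.IsCoord j x) (hd : X.HasDegree d)
    (M : IntermediateField K X.functionField) {f : X.functionField} (hf : f ∈ M)
    (hft : Transcendental K f) (y : X.functionField) : IsAlgebraic M y := by
  by_contra hy
  obtain ⟨-, a, b, -, -, hb, hfab⟩ := hx.exists_eq_div f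
  obtain ⟨-, c, e, -, -, he, hyce⟩ := hx.exists_eq_div y
  obtain ⟨C₀, M₀, hM₀⟩ := hx.exists_finrank_formSpace hd
  let s := 1 + (a * e).totalDegree + (b * e).totalDegree + (c * b).totalDegree
  -- Chosen so that $(N+1)^2>2dsN+C_0$, and so that $2Ns\ge M_0$ lies in the range of the Hilbert
  -- polynomial.
  let N : ℕ := M₀ + 2 * d * s + C₀.natAbs
  have hli := Transcendental.linearIndependent_pow_mul_pow (S := M) (f := ⟨f, hf⟩) hft hy (N + 1)
  rw [show algebraMap M X.functionField ⟨f, hf⟩ = f from rfl] at hli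
  have hbe : aeval x (b * e) ≠ 0 := by rw [map_mul]; exact mul_ne_zero hb he
  have hfB : f * aeval x (b * e) = aeval x (a * e) := by
    rw [hfab, map_mul, map_mul, ← mul_assoc, div_mul_cancel₀ _ hb]
  have hyB : y * aeval x (b * e) = aeval x (c * b) := by
    rw [hyce, map_mul, map_mul, mul_comm (aeval x b), ← mul_assoc, div_mul_cancel₀ _ he]
  have hli' := hli.map' (LinearMap.mulLeft K (aeval x (b * e) ^ (2 * N)))
    (LinearMap.ker_eq_bot.2 fun _ _ h => mul_left_cancel₀ (pow_ne_zero _ hbe) h)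
  have hmem (p : Fin (N + 1) × Fin (N + 1)) : aeval x (b * e) ^ (2 * N) *
      (f ^ (p.1 : ℕ) * y ^ (p.2 : ℕ)) ∈ formSpace x (2 * N * s) := by
    obtain ⟨i, k⟩ := p
    have hi := i.2
    have hk := k.2
    have h1 : aeval x (b * e) ^ (2 * N) * (f ^ (i : ℕ) * y ^ (k : ℕ)) =
        aeval x ((a * e) ^ (i : ℕ) * (c * b) ^ (k : ℕ) * (b * e) ^ (2 * N - i - k)) := by
      rw [map_mul _ (_ * _) (_ ^ _), map_mul _ (_ ^ _) (_ ^ _), map_pow, map_pow, map_pow, ← hfB,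
        ← hyB, mul_pow, mul_pow]
      have : 2 * N = i + k + (2 * N - i - k) := by omega
      conv_lhs => rw [this, pow_add, pow_add]
      ring
    have h2 : ((a * e) ^ (i : ℕ) * (c * b) ^ (k : ℕ) * (b * e) ^ (2 * N - i - k)).totalDegree ≤
        2 * N * s := by
      refine (totalDegree_mul _ _).trans ((add_le_add ((totalDegree_mul _ _).trans
        (add_le_add (totalDegree_pow _ _) (totalDegree_pow _ _))) (totalDegree_pow _ _)).trans ?_)
      have : 2 * N * s = i * s + k * s + (2 * N - i - k) * s := by
        rw [← add_mul, ← add_mul]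
        congr 1
        omega
      rw [this]
      gcongr <;> omega
    obtain ⟨G, hG, hGx, -⟩ := hx.exists_aeval_eq _ h2
    rw [h1, ← hGx]
    exact mem_formSpace hG
  have hcard : (N + 1) * (N + 1) ≤ Module.finrank K (formSpace x (2 * N * s)) := by
    have := finrank_span_eq_card hli'
    rw [Fintype.card_prod, Fintype.card_fin] at this
    rw [← this]
    refine Submodule.finrank_mono (Submodule.span_le.2 ?_)
    rintro _ ⟨p, rfl⟩
    exact hmem p
  have hs : 1 ≤ s := by omega
  have h3 := hM₀ (2 * N * s) (by
    have : M₀ ≤ N := by omega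
    nlinarith)
  have h4 : ((N : ℤ) + 1) * (N + 1) ≤ d * (2 * N * s : ℕ) + C₀ := by
    rw [← h3]; exact_mod_cast hcard
  have h5 : (N : ℤ) = M₀ + 2 * d * s + |C₀| := by
    simp only [N]; push_cast; rfl
  have h6 := le_abs_self C₀
  have h7 : (0 : ℤ) ≤ N := by positivity
  have h8 : (0 : ℤ) ≤ M₀ := by positivity
  have h9 : (0 : ℤ) ≤ |C₀| := abs_nonneg _
  push_cast at h4
  have h10 : (N : ℤ) * (2 * d * s) = N * (N - M₀ - |C₀|) := by rw [h5]; ring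
  have h11 : (d : ℤ) * (2 * N * s) = N * (2 * d * s) := by ring
  rw [h11, h10] at h4
  nlinarith [mul_nonneg h7 h8, mul_nonneg h7 h9]

lemma IsCoord.adjoin_eq_top (hx : X.IsCoord j x) (M : IntermediateField K X.functionField) :
    IntermediateField.adjoin M (Set.range x) = ⊤ := by
  refine eq_top_iff.2 fun y _ => ?_
  have hxi (i) : x i ∈ IntermediateField.adjoin M (Set.range x) :=
    IntermediateField.subset_adjoin _ _ (Set.mem_range_self i)
  have h (F : MvPolynomial (Fin (n + 1)) K) :
      aeval x F ∈ IntermediateField.adjoin M (Set.range x) := by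
    rw [aeval_def, eval₂_eq]
    refine sum_mem fun s _ => mul_mem ?_ (prod_mem fun i _ => pow_mem (hxi i) _)
    rw [IsScalarTower.algebraMap_apply K M X.functionField]
    exact IntermediateField.algebraMap_mem _ _
  obtain ⟨-, f, g, -, -, -, rfl⟩ := hx.exists_eq_div y
  exact div_mem (h f) (h g)

lemma IsCoord.finiteDimensional (hx : X.IsCoord j x) (hd : X.HasDegree d)
    (M : IntermediateField K X.functionField) {f : X.functionField} (hf : f ∈ M)
    (hft : Transcendental K f) : FiniteDimensional M X.functionField := by
  have h := IntermediateField.finiteDimensional_adjoin (K := M) (S := Set.range x)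
    fun y _ => (hx.isAlgebraic hd M hf hft y).isIntegral
  rw [hx.adjoin_eq_top M] at h
  exact Module.Finite.equiv (IntermediateField.topEquiv (F := M) (E := X.functionField)).toLinearEquiv

/-- Rational functions that give, at the general point, dual coordinates of the osculating
hyperplane. -/
structure IsGaussCoord (ε : Fin (n + 1) → ℕ) (f : Fin (n + 1) → X.functionField)
    (k : Fin (n + 1)) : Prop where
  self : f k = 1
  finite : {P : X.points | ¬ ((∀ i, f i ∈ X.regularAt P) ∧ ∀ H,
    X.interMult P H = ε (Fin.last n) →
      ∃ c : K, c ≠ 0 ∧ (fun i => X.valueAt P (f i)) = c • H.rep)}.Finite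

/-- The derivatives of orders $\varepsilon_0,\dots,\varepsilon_{n-1}$ give $n$ linear equations in
$n+1$ unknowns over the function field. A nonzero solution, scaled to have one coordinate $1$,
specializes to the osculating hyperplane. -/
lemma exists_isGaussCoord (hd : X.HasDegree d) (hε : X.IsOrderSequence ε) (hn : n ≠ 0)
    (hD : IsHasseDerivative t D) (hx : X.IsCoord j x) :
    ∃ (f : Fin (n + 1) → X.functionField) (k : Fin (n + 1)), IsGaussCoord ε f k := by
  let A : Matrix (Fin n) (Fin (n + 1)) X.functionField := fun l i => D (ε l.castSucc) (x i)
  have hker : LinearMap.ker A.mulVecLin ≠ ⊥ := LinearMap.ker_ne_bot_of_finrank_lt (by simp)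
  obtain ⟨w, hw, hw0⟩ := Submodule.exists_mem_ne_zero_of_ne_bot hker
  obtain ⟨k, hk⟩ := Function.ne_iff.1 hw0
  have hw' (l : Fin n) : ∑ i, D (ε l.castSucc) (x i) * ((w k)⁻¹ * w i) = 0 := by
    have h1 : ∑ i, D (ε l.castSucc) (x i) * w i = 0 := congrFun (LinearMap.mem_ker.1 hw) l
    simp_rw [mul_left_comm _ (w k)⁻¹, ← Finset.mul_sum, h1, mul_zero]
  refine ⟨fun i => (w k)⁻¹ * w i, k, inv_mul_cancel₀ hk, ?_⟩
  refine ((finite_not_isGenericPoint hd hε hD hx).union (Set.finite_iUnion fun i =>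
    finite_notMem_regularAt hd ((w k)⁻¹ * w i))).subset fun P hP => ?_
  by_contra h
  simp only [Set.mem_union, Set.mem_ofPred_eq, Set.mem_iUnion, not_or, not_exists, not_not] at h
  obtain ⟨hgen, hreg⟩ := h
  refine hP ⟨hreg, fun H hH => ?_⟩
  obtain ⟨c, hc⟩ := hgen.eq_smul_of_dotProduct_eq_zero hε hn hD hx hH
    (b := fun i => X.valueAt P ((w k)⁻¹ * w i)) fun l => by
      have hDr (i) : D (ε l.castSucc) (x i) ∈ X.regularAt P :=
        hgen.preservesRegular _ (hε.1.monotone (Fin.le_last _)) _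
          (hx.mem_regularAt hgen.rep_ne_zero i)
      have h2 := congrArg (X.valueAt P) (hw' l)
      rw [valueAt_sum _ _ fun i _ => Subalgebra.mul_mem _ (hDr i) (hreg i), valueAt_zero] at h2
      rw [dotProduct_comm, ← h2]
      exact Finset.sum_congr rfl fun i _ => (valueAt_mul (hDr i) (hreg i)).symm
  refine ⟨c, fun hc0 => ?_, hc⟩
  have := congrFun hc k
  simp [hc0, inv_mul_cancel₀ hk] at this

namespace IsGaussCoord

variable {f : Fin (n + 1) → X.functionField} {k : Fin (n + 1)} (hf : IsGaussCoord ε f k)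
  (hd : X.HasDegree d) (hε : X.IsOrderSequence ε)
include hf hε

/-- The function $f_i$ is the pullback under $\gamma$ of the ratio of dual coordinates $X_i/X_k$. -/
lemma mem_dualFunctionField (i : Fin (n + 1)) : f i ∈ X.dualFunctionField := by
  refine IntermediateField.subset_adjoin _ _ ⟨1, MvPolynomial.X i, MvPolynomial.X k,
    isHomogeneous_X _ _, isHomogeneous_X _ _, (hf.finite.union hε.2).subset fun P hP => ?_⟩
  by_contra h
  simp only [Set.mem_union, Set.mem_ofPred_eq, not_or, not_not] at h
  obtain ⟨⟨hreg, hH⟩, hns, hord⟩ := h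
  obtain ⟨H, hHε⟩ : ε (Fin.last n) ∈ X.orders P := by rw [hord]; exact ⟨_, rfl⟩
  obtain ⟨c, hc0, hc⟩ := hH H hHε
  have hk : 1 = c * H.rep k := by
    have := congrFun hc k
    simpa [hf.self] using this
  have hHk : H.rep k ≠ 0 := fun h0 => by simp [h0] at hk
  refine hP ⟨H, ⟨hns, _, ⟨⟨H, hHε⟩, ?_⟩, hHε⟩, by simpa using hHk, ?_⟩
  · rw [hord]
    rintro _ ⟨l, rfl⟩
    exact hε.1.monotone (Fin.le_last l)
  · rw [eval_X, eval_X, ← mul_div_mul_left _ _ hc0, ← hk, div_one]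
    have := hasValueAt_valueAt (hreg i)
    rwa [congrFun hc i] at this

include hd in
-- If all $f_i=c_i$ were constant, $\sum c_ix_i$ would vanish at almost every point and so be zero.
-- Yet its derivative of order $\varepsilon_n$ is nonzero at a general point.
lemma exists_transcendental [IsAlgClosed K] (hn : n ≠ 0) (hD : IsHasseDerivative t D)
    (hx : X.IsCoord j x) : ∃ i, Transcendental K (f i) := by
  by_contra! hall
  have hall' (i) : f i ∈ Set.range (algebraMap K X.functionField) := by
    by_contra h
    exact hall i (IsAlgClosed.transcendental_of_notMem_range h)
  choose c hc using hall'
  have := hx.infinite_points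
  have hbad := (finite_not_isGenericPoint hd hε hD hx).union hf.finite
  have hdual (P : X.points) (hP : IsGenericPoint ε j t D P) (hf' : (∀ i, f i ∈ X.regularAt P) ∧
      ∀ H, X.interMult P H = ε (Fin.last n) →
        ∃ c : K, c ≠ 0 ∧ (fun i => X.valueAt P (f i)) = c • H.rep) :
      c ⬝ᵥ derivVector D x P 0 = 0 ∧ c ⬝ᵥ derivVector D x P (ε (Fin.last n)) ≠ 0 := by
    obtain ⟨H, hH⟩ := hP.exists_osculating
    obtain ⟨a, ha0, ha⟩ := hf'.2 H hH
    have hca : c = a • H.rep := by rw [← ha]; ext i; simp [← hc]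
    obtain ⟨h1, h2⟩ := hP.dotProduct_derivVector hε hn hD hx hH
    have h3 : ε 0 < ε (Fin.last n) :=
      hε.1 (by rw [Fin.lt_def]; simpa using Nat.pos_of_ne_zero hn)
    rw [hca, smul_dotProduct, smul_dotProduct, h1 0 (by omega), smul_zero]
    exact ⟨rfl, smul_ne_zero ha0 h2⟩
  have hval (P : X.points) (hP : IsGenericPoint ε j t D P) (m : ℕ)
      (hm : m ≤ ε (Fin.last n)) :
      X.valueAt P (D m (∑ i, c i • x i)) = c ⬝ᵥ derivVector D x P m := by
    have hr (i) : D m (x i) ∈ X.regularAt P :=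
      hP.preservesRegular m hm _ (hx.mem_regularAt hP.rep_ne_zero i)
    simp only [map_sum, map_smul]
    rw [valueAt_sum _ _ fun i _ => Subalgebra.smul_mem _ (hr i) _]
    exact Finset.sum_congr rfl fun i _ => valueAt_smul _ (hr i)
  have hb : ∑ i, c i • x i = 0 := by
    by_contra hb
    obtain ⟨P, hP⟩ := (hbad.union (finite_valueAt_eq_zero hd hb)).infinite_compl.nonempty
    simp only [Set.mem_compl_iff, Set.mem_union, Set.mem_ofPred_eq, not_or, not_not] at hP
    obtain ⟨⟨h1, h2⟩, h3⟩ := hP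
    have h4 := hval P h1 0 (Nat.zero_le _)
    rw [hD.zero] at h4
    exact h3 (h4.trans (hdual P h1 h2).1)
  obtain ⟨P, hP⟩ := hbad.infinite_compl.nonempty
  simp only [Set.mem_compl_iff, Set.mem_union, Set.mem_ofPred_eq, not_or, not_not] at hP
  have h4 := hval P hP.1 _ le_rfl
  rw [hb, map_zero, valueAt_zero] at h4
  exact (hdual P hP.1 hP.2).2 h4.symm

end IsGaussCoord

end

section

/-! ### The bound for the number of points with the same osculating hyperplane -/

variable {K : Type*} [Field K] {n : ℕ} {X : ProjectiveCurve K n}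
variable {P : X.points} {t : X.functionField} {D : ℕ → X.functionField →ₗ[K] X.functionField}
  {d N : ℕ} {j : Fin (n + 1)} {x : Fin (n + 1) → X.functionField} {ε : Fin (n + 1) → ℕ}

/-- The affine coordinates of a point in the `j`-th chart. -/
def affineCoord (j : Fin (n + 1)) (P : X.points) (i : Fin (n + 1)) : K := P.1.rep i / P.1.rep j

/-- The ideal of the polynomials whose first `k` Hasse derivatives vanish at `P`. -/
def derivIdeal (hD : IsHasseDerivative t D) (hx : X.IsCoord j x) (hP : P.1.rep j ≠ 0)
    (hreg : PreservesRegular D N P) (k : ℕ) (hk : k ≤ N) : Ideal (MvPolynomial (Fin (n + 1)) K) where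
  carrier := {F | ∀ i < k, X.valueAt P (D i (aeval x F)) = 0}
  zero_mem' := fun i _ => by rw [map_zero, map_zero, valueAt_zero]
  add_mem' := fun {F G} hF hG i hi => by
    have hr (F) := hreg i (hi.le.trans hk) _ (hx.aeval_mem_regularAt hP F)
    rw [map_add, map_add, valueAt_add (hr F) (hr G), hF i hi, hG i hi, add_zero]
  smul_mem' := fun G F hF i hi => by
    rw [smul_eq_mul, map_mul]
    exact hD.valueAt_map_mul_eq_zero (e := 0) (f := k) hreg (hx.aeval_mem_regularAt hP G)
      (hx.aeval_mem_regularAt hP F) (by simp) hF (by omega) (by omega)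

/-! ### Jets along the curve as conditions on polynomials -/

section derivIdeal

variable (hD : IsHasseDerivative t D) (hx : X.IsCoord j x) (hP : P.1.rep j ≠ 0)
  (hreg : PreservesRegular D N P)

/-- Containing a power of the maximal ideal of the point makes these ideals coprime at distinct
points. -/
lemma ker_eval_pow_le_derivIdeal (k : ℕ) (hk : k ≤ N) :
    RingHom.ker (eval (affineCoord j P)) ^ k ≤ derivIdeal hD hx hP hreg k hk := by
  induction k with
  | zero =>
    intro F _ i hi
    exact absurd hi (Nat.not_lt_zero i)
  | succ k ih =>
    rw [pow_succ]
    refine (Ideal.mul_mono_left (ih (by omega))).trans (Ideal.mul_le.2 fun F hF G hG i hi => ?_)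
    rw [map_mul]
    refine hD.valueAt_map_mul_eq_zero (e := k) (f := 1) hreg (hx.aeval_mem_regularAt hP F)
      (hx.aeval_mem_regularAt hP G) hF (fun l hl => ?_) hi (by omega)
    rw [Nat.lt_one_iff.1 hl, hD.zero, hx.valueAt_aeval hP]
    exact hG

/-- The numerator $T$ of $t-t(P)$ vanishes at $P$ with nonzero first derivative, so the derivatives
of $1,T,\dots,T^{N-1}$ at $P$ form an invertible triangular matrix. -/
lemma exists_linearIndependent_derivIdeal (hN : 1 ≤ N) (ht : t ∈ X.regularAt P) :
    ∃ v : Fin N → MvPolynomial (Fin (n + 1)) K, LinearIndependent K fun k =>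
      Ideal.Quotient.mk (derivIdeal hD hx hP hreg N le_rfl) (v k) := by
  obtain ⟨A, B, hB, htAB⟩ := hx.exists_eq_div_of_mem_regularAt hP ht
  have hB0 : aeval x B ≠ 0 := fun h0 => hB (by rw [h0, valueAt_zero])
  let c := X.valueAt P t
  let T := A - C c * B
  have hr := hx.aeval_mem_regularAt hP
  have htc : t - algebraMap K _ c ∈ X.regularAt P :=
    Subalgebra.sub_mem _ ht (Subalgebra.algebraMap_mem _ _)
  have htc0 : X.valueAt P (t - algebraMap K _ c) = 0 := by
    have h := valueAt_add htc (Subalgebra.algebraMap_mem (X.regularAt P) c)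
    rw [sub_add_cancel, valueAt_algebraMap] at h
    exact add_eq_right.1 h.symm
  have hT : aeval x T = (t - algebraMap K _ c) * aeval x B := by
    rw [sub_mul, htAB, div_mul_cancel₀ _ hB0]
    simp [T]
  have hT0 : X.valueAt P (aeval x T) = 0 := by
    rw [hT, valueAt_mul htc (hr B), htc0, zero_mul]
  have hT1 : X.valueAt P (D 1 (aeval x T)) ≠ 0 := by
    rw [hT, hD.valueAt_map_mul hreg htc (hr B) hN, Finset.sum_range_succ, Finset.sum_range_one,
      hD.zero, htc0, zero_mul, zero_add, map_sub, hD.one_self, hD.map_algebraMap one_ne_zero,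
      sub_zero, valueAt_one, one_mul, hD.zero]
    exact hB
  refine ⟨fun k => T ^ (k : ℕ), Fintype.linearIndependent_iff.2 fun a ha => ?_⟩
  let M : Matrix (Fin N) (Fin N) K := fun i k => X.valueAt P (D i (aeval x (T ^ (k : ℕ))))
  have hMpow (k : Fin N) := hD.valueAt_map_pow hreg (hr T) hT0 k.2.le
  have hMt : M.IsLowerTriangular := fun i k hik => by
    simp only [M, map_pow]
    exact (hMpow k).1 i hik
  have hdet : M.det ≠ 0 := by
    rw [Matrix.det_of_isLowerTriangular M hMt]
    refine Finset.prod_ne_zero_iff.2 fun k _ => ?_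
    simp only [M, map_pow]
    rw [(hMpow k).2]
    exact pow_ne_zero _ hT1
  have hmem : ∑ k, a k • T ^ (k : ℕ) ∈ derivIdeal hD hx hP hreg N le_rfl := by
    rw [← Ideal.Quotient.eq_zero_iff_mem, ← ha, map_sum]
    rfl
  refine congrFun (Matrix.eq_zero_of_mulVec_eq_zero hdet (funext fun i => ?_))
  have h := hmem i i.2
  have hri (k : Fin N) := hreg i i.2.le _ (hr (T ^ (k : ℕ)))
  simp only [map_sum, map_smul] at h
  rw [valueAt_sum _ _ fun k _ => Subalgebra.smul_mem _ (hri k) _] at h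
  change ∑ k, M i k * a k = 0
  rw [← h]
  exact Finset.sum_congr rfl fun k _ => by rw [valueAt_smul _ (hri k), mul_comm]

end derivIdeal

/-! ### Frobenius maps on points and on the function field -/

lemma _root_.FiniteField.frobeniusAlgHom_pow_apply (F : Type*) {K : Type*} [Field F] [Fintype F]
    [Field K] [Algebra F K] (r : ℕ) (c : K) :
    (FiniteField.frobeniusAlgHom F K ^ r : K →ₐ[F] K) c = c ^ Fintype.card F ^ r := by
  induction r with
  | zero => simp
  | succ r ih =>
    rw [pow_succ', AlgHom.mul_apply, ih, FiniteField.frobeniusAlgHom_apply, ← pow_mul, pow_succ]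

/-- The coordinatewise Frobenius map preserves a curve defined over `F`. -/
lemma IsCoord.eval_pow_card_eq_zero {F : Type*} [Field F] [Fintype F] [Algebra F K]
    (hX : X.IsDefinedOver F) (hx : X.IsCoord j x) (hP : P.1.rep j ≠ 0) (r : ℕ)
    {G : MvPolynomial (Fin (n + 1)) K} (hG : aeval x G = 0) :
    eval (fun i => affineCoord j P i ^ Fintype.card F ^ r) G = 0 := by
  obtain ⟨J, hJ⟩ := hX
  have hPj : affineCoord j P j = 1 := div_self hP
  obtain ⟨G', hG', hGx, hGe⟩ := hx.exists_aeval_eq G le_rfl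
  rw [← hGe _ (by rw [hPj, one_pow])]
  rw [← hGx, hx.aeval_eq_zero_iff hG'] at hG
  -- This map fixes the coefficients of the equations over `F`, hence sends zeros to zeros.
  let φ : K →ₐ[F] K := FiniteField.frobeniusAlgHom F K ^ r
  have hφ (c : K) : φ c = c ^ Fintype.card F ^ r := FiniteField.frobeniusAlgHom_pow_apply F r c
  have hle : X.ideal ≤ RingHom.ker (eval fun i => affineCoord j P i ^ Fintype.card F ^ r) := by
    rw [hJ, Ideal.map_le_iff_le_comap]
    intro f hf
    rw [Ideal.mem_comap, RingHom.mem_ker, eval_map, ← aeval_def]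
    have h0 : aeval (affineCoord j P) f = 0 := by
      rw [aeval_def, ← eval_map]
      have hmem : MvPolynomial.map (algebraMap F K) f ∈ X.ideal := hJ ▸ Ideal.mem_map_of_mem _ hf
      have h1 : affineCoord j P = fun i => (P.1.rep j)⁻¹ * P.1.rep i :=
        funext fun i => div_eq_inv_mul _ _
      have h2 : aeval x (MvPolynomial.map (algebraMap F K) f) = 0 := by
        rw [← sum_homogeneousComponent (MvPolynomial.map (algebraMap F K) f), map_sum]
        exact Finset.sum_eq_zero fun m _ => (hx.aeval_eq_zero_iff
          (homogeneousComponent_isHomogeneous m _)).2 (X.isHomogeneous _ hmem m)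
      have h3 := hx.valueAt_aeval hP (MvPolynomial.map (algebraMap F K) f)
      rw [h2, valueAt_zero] at h3
      exact h3.symm
    have h1 := congrArg φ h0
    have h2 := DFunLike.congr_fun (comp_aeval (affineCoord j P) φ) f
    simp only [hφ] at h2
    rw [← h2]
    exact h1.trans (map_zero φ)
  exact hle hG

/-- If the extension of the function field is generated by `Q`-th powers under an embedding, then
every function is a `Q`-th power, which is impossible for an element with nonzero derivative. -/
lemma IsCoord.not_forall_eq_pow [IsAlgClosed K] (hx : X.IsCoord j x) (hD : IsHasseDerivative t D)
    (M : IntermediateField K X.functionField) [FiniteDimensional M X.functionField]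
    {Ω : Type*} [Field Ω] [Algebra K Ω] [Algebra M Ω] [IsScalarTower K M Ω]
    (σ τ : X.functionField →ₐ[M] Ω) {p m : ℕ} [Fact p.Prime] [CharP K p] (hm : m ≠ 0) :
    ¬ ∀ i, σ (x i) = τ (x i) ^ p ^ m := by
  intro h
  have : CharP X.functionField p := charP_of_injective_algebraMap (algebraMap K _).injective p
  have hp : 0 < p ^ m := pow_pos (Fact.out : p.Prime).pos m
  have hpoly (F : MvPolynomial (Fin (n + 1)) K) : ∃ z, σ (aeval x F) = τ (z ^ p ^ m) := by
    induction F using MvPolynomial.induction_on with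
    | C c =>
      obtain ⟨c', hc'⟩ := IsAlgClosed.exists_pow_nat_eq c hp
      refine ⟨algebraMap K _ c', ?_⟩
      rw [← map_pow, hc', ← algebraMap_eq, AlgHom.commutes]
      exact (((σ.restrictScalars K).commutes c).trans ((τ.restrictScalars K).commutes c).symm)
    | add F G hF hG =>
      obtain ⟨z, hz⟩ := hF
      obtain ⟨w, hw⟩ := hG
      exact ⟨z + w, by rw [map_add, map_add, hz, hw, add_pow_char_pow, map_add]⟩
    | mul_X F i hF =>
      obtain ⟨z, hz⟩ := hF
      exact ⟨z * x i, by rw [map_mul, map_mul, aeval_X, hz, h i, mul_pow, map_mul, map_pow τ (x i)]⟩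
  have hall (y : X.functionField) : ∃ z, σ y = τ (z ^ p ^ m) := by
    obtain ⟨-, f, g, -, -, -, rfl⟩ := hx.exists_eq_div y
    obtain ⟨z, hz⟩ := hpoly f
    obtain ⟨w, hw⟩ := hpoly g
    exact ⟨z / w, by rw [map_div₀, hz, hw, div_pow, map_div₀]⟩
  -- The image of `σ` lies in that of `τ`, and both have the same finite dimension over `M`. Hence
  -- `τ t` is in the image of `σ`, which makes `t` a $p^m$-th power, with zero first derivative.
  have hrange : LinearMap.range σ.toLinearMap = LinearMap.range τ.toLinearMap := by
    refine Submodule.eq_of_le_of_finrank_eq ?_ ?_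
    · rintro _ ⟨y, rfl⟩
      obtain ⟨z, hz⟩ := hall y
      exact ⟨_, hz.symm⟩
    · rw [LinearMap.finrank_range_of_inj σ.injective, LinearMap.finrank_range_of_inj τ.injective]
  obtain ⟨y, hy⟩ : τ t ∈ LinearMap.range σ.toLinearMap := hrange ▸ ⟨t, rfl⟩
  obtain ⟨z, hz⟩ := hall y
  have htz : t = z ^ p ^ m := τ.injective (hy.symm.trans hz)
  have h1 := hD.one_self
  rw [htz, hD.one_pow, Nat.cast_pow, CharP.cast_eq_zero, zero_pow hm, zero_mul, zero_mul] at h1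
  exact zero_ne_one h1

/-- Specializing embeddings of the function field that agree on the Gauss map yields points with a
common osculating hyperplane, to which Bézout's inequality applies. -/
lemma card_mul_le [IsAlgClosed K] {F : Type*} [Field F] [Fintype F] [Algebra F K]
    (hX : X.IsDefinedOver F) (hd : X.HasDegree d) (hε : X.IsOrderSequence ε) (hn : n ≠ 0)
    (hD : IsHasseDerivative t D) (hx : X.IsCoord j x) {f : Fin (n + 1) → X.functionField}
    {k : Fin (n + 1)} (hf : IsGaussCoord ε f k) {ℓ : ℕ}
    (hfrob : {P : X.points | ¬ ∀ r < ℓ, ∀ H, X.interMult P H = ε (Fin.last n) →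
      H.rep ⬝ᵥ (fun i => P.1.rep i ^ Fintype.card F ^ (r + 1)) = 0}.Finite)
    {Ω ι : Type*} [Field Ω] [Algebra K Ω] [Fintype ι] [Nonempty ι]
    (σ : ι → X.functionField →ₐ[K] Ω) (w : Fin (n + 1) → Ω) (hw : ∀ a i, σ a (f i) = w i)
    (hσ : ∀ a b, ∀ s ≤ ℓ, (∀ i, σ a (x i) = σ b (x i) ^ Fintype.card F ^ s) → s = 0 ∧ a = b) :
    Fintype.card ι * (ε (Fin.last n) + ℓ) ≤ d := by
  let q := Fintype.card F
  -- The first set lets the common Gauss image specialize. The nonzero differences in the second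
  -- keep distinct points and Frobenius images distinct.
  let G : Set Ω := Set.range w ∪ Set.range fun c : ι × ι × Fin (ℓ + 1) × Fin (n + 1) =>
    σ c.1 (x c.2.2.2) - σ c.2.1 (x c.2.2.2) ^ q ^ (c.2.2.1 : ℕ)
  have hG : G.Finite := (Set.finite_range _).union (Set.finite_range _)
  obtain ⟨R, φ, P, hGR, hφ, hxR, hP⟩ := hx.exists_points σ hG
    (((finite_not_isGenericPoint hd hε hD hx).union hf.finite).union hfrob)
  have hPgen (a) : IsGenericPoint ε j t D (P a) := by
    by_contra h
    exact (hP a).1 (Or.inl (Or.inl h))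
  have hPf (a) : (∀ i, f i ∈ X.regularAt (P a)) ∧ ∀ H, X.interMult (P a) H = ε (Fin.last n) →
      ∃ c : K, c ≠ 0 ∧ (fun i => X.valueAt (P a) (f i)) = c • H.rep := by
    by_contra h
    exact (hP a).1 (Or.inl (Or.inr h))
  have hPfrob (a) : ∀ r < ℓ, ∀ H, X.interMult (P a) H = ε (Fin.last n) →
      H.rep ⬝ᵥ (fun i => (P a).1.rep i ^ q ^ (r + 1)) = 0 := by
    by_contra h
    exact (hP a).1 (Or.inr h)
  have hPj (a) := (hPgen a).rep_ne_zero
  have hreg (a) := (hPgen a).preservesRegular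
  have hcoord (a i) : affineCoord j (P a) i = φ ⟨σ a (x i), hxR a i⟩ := by
    rw [← (hP a).2.2 _ (hx.mem_regularAt (hPj a) i), hx.valueAt_eq (hPj a)]; rfl
  have hqinj (r : ℕ) : Function.Injective fun c : K => c ^ q ^ r := by
    have : (fun c : K => c ^ q ^ r) = (FiniteField.frobeniusAlgHom F K ^ r : K →ₐ[F] K) :=
      funext fun c => (FiniteField.frobeniusAlgHom_pow_apply F r c).symm
    rw [this]
    exact RingHom.injective _
  let pt (c : ι × Fin (ℓ + 1)) (i : Fin (n + 1)) : K := affineCoord j (P c.1) i ^ q ^ (c.2 : ℕ)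
  -- Cancelling the injective $q^r$-power map reduces a coincidence to $P_a=\mathrm{Fr}^{s-r}(P_b)$.
  -- The elements of `G` lift this relation back to the embeddings, where `hσ` applies.
  have hpt_aux (a b : ι) (r s : Fin (ℓ + 1)) (hrs : r ≤ s) (h : pt (a, r) = pt (b, s)) :
      (a, r) = (b, s) := by
    have hs : (s : ℕ) = (s - r : ℕ) + r := (Nat.sub_add_cancel hrs).symm
    have h1 (i) : affineCoord j (P a) i = affineCoord j (P b) i ^ q ^ (s - r : ℕ) := by
      refine hqinj r ((congrFun h i).trans ?_)
      change affineCoord j (P b) i ^ q ^ (s : ℕ) = (affineCoord j (P b) i ^ q ^ (s - r : ℕ)) ^ _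
      rw [← pow_mul, ← pow_add, ← hs]
    obtain ⟨h2, rfl⟩ := hσ a b (s - r : ℕ) (by omega) fun i => by
      by_contra hne
      have hmem : σ a (x i) - σ b (x i) ^ q ^ (s - r : ℕ) ∈ G :=
        Or.inr ⟨(a, b, ⟨s - r, by omega⟩, i), rfl⟩
      refine hφ ⟨_, hGR hmem⟩ hmem (sub_ne_zero.2 hne) ?_
      have h3 : (⟨_, hGR hmem⟩ : R) =
          ⟨σ a (x i), hxR a i⟩ - ⟨σ b (x i), hxR b i⟩ ^ q ^ (s - r : ℕ) := rfl
      rw [h3, map_sub, map_pow, ← hcoord, ← hcoord, h1, sub_self]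
    rw [Prod.mk.injEq]
    exact ⟨rfl, Fin.ext (by have : (r : ℕ) ≤ s := hrs; omega)⟩
  have hpt : Function.Injective pt := by
    rintro ⟨a, r⟩ ⟨b, s⟩ h
    rcases le_total r s with hrs | hrs
    · exact hpt_aux a b r s hrs h
    · exact (hpt_aux b a s r hrs h.symm).symm
  have hwR (i) : w i ∈ R := hGR (Or.inl ⟨i, rfl⟩)
  let u (i : Fin (n + 1)) : K := φ ⟨w i, hwR i⟩
  have hu (a) : ∃ H, X.interMult (P a) H = ε (Fin.last n) ∧ ∃ c : K, c ≠ 0 ∧ u = c • H.rep := by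
    obtain ⟨H, hH⟩ := (hPgen a).exists_osculating
    obtain ⟨c, hc0, hc⟩ := (hPf a).2 H hH
    refine ⟨H, hH, c, hc0, ?_⟩
    rw [← hc]
    ext i
    rw [(hP a).2.2 _ ((hPf a).1 i) (by rw [hw]; exact hwR i)]
    exact congrArg φ (Subtype.ext (hw a i).symm)
  let B : MvPolynomial (Fin (n + 1)) K := ∑ i, C (u i) * MvPolynomial.X i
  have hB : B.IsHomogeneous 1 := IsHomogeneous.sum _ _ _ fun i _ => by
    simpa using (isHomogeneous_C (Fin (n + 1)) (u i)).mul (isHomogeneous_X K i)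
  have hBx : aeval x B = ∑ i, u i • x i := by simp [B, Algebra.smul_def]
  have hBe (v : Fin (n + 1) → K) : eval v B = u ⬝ᵥ v := by simp [B, dotProduct]
  have hBD (a) (m : ℕ) (hm : m ≤ ε (Fin.last n)) :
      X.valueAt (P a) (D m (aeval x B)) = u ⬝ᵥ derivVector D x (P a) m := by
    have hr (i) := hreg a m hm _ (hx.mem_regularAt (hPj a) i)
    simp only [hBx, map_sum, map_smul]
    rw [valueAt_sum _ _ fun i _ => Subalgebra.smul_mem _ (hr i) _]
    exact Finset.sum_congr rfl fun i _ => valueAt_smul _ (hr i)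
  have hN : 1 ≤ ε (Fin.last n) := by
    have h3 : ε 0 < ε (Fin.last n) :=
      hε.1 (by rw [Fin.lt_def]; simpa using Nat.pos_of_ne_zero hn)
    omega
  have hB0 : aeval x B ≠ 0 := fun h0 => by
    obtain ⟨a⟩ := ‹Nonempty ι›
    obtain ⟨H, hH, c, hc0, hc⟩ := hu a
    have h1 := hBD a _ le_rfl
    rw [h0, map_zero, valueAt_zero, hc, smul_dotProduct] at h1
    exact smul_ne_zero hc0 ((hPgen a).dotProduct_derivVector hε hn hD hx hH).2 h1.symm
  choose v₀ hv₀ using fun a => exists_linearIndependent_derivIdeal hD hx (hPj a) (hreg a) hN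
    (hPgen a).mem_regularAt
  have hker (c) (G) (hG : aeval x G = 0) : eval (pt c) G = 0 :=
    hx.eval_pow_card_eq_zero hX (hPj c.1) c.2 hG
  -- Local contributions to Bézout for the common hyperplane `B`: the point itself (`c.2 = 0`) gives
  -- $\varepsilon_n$ through its jets, and each of its $\ell$ Frobenius images gives $1$ through its
  -- maximal ideal.
  have hdata (c : ι × Fin (ℓ + 1)) : ∃ (m : ℕ) (J : Ideal (MvPolynomial (Fin (n + 1)) K))
      (v : Fin m → MvPolynomial (Fin (n + 1)) K),
      (m = if c.2 = 0 then ε (Fin.last n) else 1) ∧ RingHom.ker (eval (pt c)) ^ ε (Fin.last n) ≤ J ∧ (∀ F, aeval x F = 0 → F ∈ J) ∧ B ∈ J ∧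
      LinearIndependent K fun m => Ideal.Quotient.mk J (v m) := by
    obtain ⟨a, r⟩ := c
    by_cases hr : r = 0
    · subst hr
      refine ⟨_, derivIdeal hD hx (hPj a) (hreg a) _ le_rfl, v₀ a, (if_pos rfl).symm, ?_, fun F hF i hi => ?_, fun i hi => ?_, hv₀ a⟩
      · have : pt (a, 0) = affineCoord j (P a) := by ext i; simp [pt]
        rw [this]
        exact ker_eval_pow_le_derivIdeal hD hx (hPj a) (hreg a) _ le_rfl
      · rw [hF, map_zero, valueAt_zero]
      · obtain ⟨H, hH, c, hc0, hc⟩ := hu a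
        rw [hBD a i hi.le, hc, smul_dotProduct,
          ((hPgen a).dotProduct_derivVector hε hn hD hx hH).1 i hi, smul_zero]
    · refine ⟨1, RingHom.ker (eval (pt (a, r))), fun _ => 1, (if_neg hr).symm, Ideal.pow_le_self (by omega),
        fun F hF => hker _ F hF, ?_, ?_⟩
      · obtain ⟨s, rfl⟩ := Fin.exists_succ_eq.2 hr
        obtain ⟨H, hH, c, hc0, hc⟩ := hu a
        have h1 := hPfrob a s s.2 H hH
        have h2 : pt (a, s.succ) =
            ((P a).1.rep j ^ q ^ ((s : ℕ) + 1))⁻¹ • fun i => (P a).1.rep i ^ q ^ ((s : ℕ) + 1) := by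
          ext i
          simp [pt, affineCoord, div_eq_inv_mul, mul_pow]
        rw [RingHom.mem_ker, hBe, hc, smul_dotProduct, h2, dotProduct_smul, h1, smul_zero, smul_zero]
      · rw [linearIndependent_unique_iff, map_one]
        have h1 : RingHom.ker (eval (pt (a, r))) ≠ ⊤ := RingHom.ker_ne_top _
        exact fun h => h1 ((Ideal.eq_top_iff_one _).2 (by
          rwa [← map_one (Ideal.Quotient.mk _), Ideal.Quotient.eq_zero_iff_mem] at h))
  choose m J v hm hJpow hJx hJB hJv using hdata
  have hbez := hx.sum_le_of_isCoprime hd hB hB0 J (fun c c' hcc' => by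
    have h1 := (isCoprime_ker_eval (hpt.ne hcc')).pow (m := ε (Fin.last n)) (n := ε (Fin.last n))
    exact Ideal.isCoprime_iff_codisjoint.2
      ((Ideal.isCoprime_iff_codisjoint.1 h1).mono (hJpow c) (hJpow c'))) hJx hJB _ v hJv
  rw [Fintype.sum_prod_type] at hbez
  simp only [hm, Fin.sum_univ_succ, Fin.succ_ne_zero, if_true, if_false, Finset.sum_const,
    Finset.card_univ, Fintype.card_fin, smul_eq_mul, mul_one] at hbez
  exact hbez

end

end ProjectiveCurve

end

/-! ### Counting embeddings over the field of the dual curve -/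

open ProjectiveCurve in
theorem mainTheorem4 {F K : Type*} [Field F] [Fintype F] [Field K] [Algebra F K] [IsAlgClosure F K]
    {n ℓ : ℕ} (hℓ : 1 ≤ ℓ) (hℓn : ℓ < n)
    (X : ProjectiveCurve K n) (hX : X.IsDefinedOver F)
    (d : ℕ) (hd : X.HasDegree d)
    (ε : Fin (n + 1) → ℕ) (hε : X.IsOrderSequence ε)
    (hν : ∀ i : ℕ, 1 ≤ i → i ≤ ℓ → ∃ ν : Fin n → ℕ,
      X.IsFrobeniusNonclassicalWith (Fintype.card F ^ i) ν ∧
      ν ⟨n - 1, by omega⟩ = ε (Fin.last n)) :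
    FiniteDimensional X.dualFunctionField X.functionField ∧
      (X.gaussSepDegree : ℚ) ≤ (d : ℚ) / ((ε (Fin.last n) : ℚ) + (ℓ : ℚ)) := by
  have : IsAlgClosed K := IsAlgClosure.isAlgClosed F
  have hn : n ≠ 0 := by omega
  have hνε (ν : Fin n → ℕ) (h : ν ⟨n - 1, by omega⟩ = ε (Fin.last n)) :
      ν ≠ fun l => ε l.castSucc := by
    rintro rfl
    exact (Fin.castSucc_lt_last _).ne (hε.1.injective h)
  have hfrob : {P : X.points | ¬ ∀ r < ℓ, ∀ H, X.interMult P H = ε (Fin.last n) →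
      H.rep ⬝ᵥ (fun i => P.1.rep i ^ Fintype.card F ^ (r + 1)) = 0}.Finite := by
    have h1 (r : Fin ℓ) : {P : X.points | ¬ ∀ H, X.interMult P H = ε (Fin.last n) →
        H.rep ⬝ᵥ (fun i => P.1.rep i ^ Fintype.card F ^ ((r : ℕ) + 1)) = 0}.Finite := by
      -- The chart and the derivation may vary with the exponent; the incidence obtained does not
      -- depend on them.
      obtain ⟨ν, ⟨⟨t, D, x, j, -, hD, hj, hxj, hleast⟩, -⟩, hlast⟩ := hν (r + 1) (by omega) r.2
      have hx : X.IsCoord j x := ⟨hj, hxj⟩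
      have := hx.infinite_points
      refine (finite_not_isGenericPoint hd hε hD hx).subset fun P hP hgen => hP fun H hH => ?_
      exact hgen.dotProduct_pow_eq_zero hd hε hn hD hx hleast (hνε ν hlast) hH
    refine (Set.finite_iUnion h1).subset fun P hP => ?_
    by_contra h
    simp only [Set.mem_iUnion, Set.mem_ofPred_eq, not_exists, not_not] at h
    exact hP fun r hr => h ⟨r, hr⟩
  obtain ⟨ν, ⟨⟨t, D, x, j, -, hD, hj, hxj, -⟩, -⟩, -⟩ := hν 1 le_rfl hℓ
  have hx : X.IsCoord j x := ⟨hj, hxj⟩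
  obtain ⟨f, k, hf⟩ := exists_isGaussCoord hd hε hn hD hx
  obtain ⟨i, hi⟩ := hf.exists_transcendental hd hε hn hD hx
  have hfin : FiniteDimensional X.dualFunctionField X.functionField :=
    hx.finiteDimensional hd _ (hf.mem_dualFunctionField hε i) hi
  refine ⟨hfin, ?_⟩
  obtain ⟨p, hp⟩ := CharP.exists F
  obtain ⟨a, hpprime, hcard⟩ := FiniteField.card F p
  have : Fact p.Prime := ⟨hpprime⟩
  have : CharP K p := charP_of_injective_algebraMap (algebraMap F K).injective p
  -- Embeddings over the dual field fix every `f i`, so the corresponding generic points share their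
  -- osculating hyperplane.
  let ι := Field.Emb X.dualFunctionField X.functionField
  have : Fintype ι := minpoly.AlgHom.fintype _ _ _
  have hle := card_mul_le hX hd hε hn hD hx hf hfrob
    (fun τ : ι => τ.restrictScalars K) (fun i => algebraMap X.dualFunctionField _
      ⟨f i, hf.mem_dualFunctionField hε i⟩)
    (fun τ i => τ.commutes ⟨f i, hf.mem_dualFunctionField hε i⟩)
    (fun σ τ s _ h => by
      have hs : s = 0 := by
        by_contra hs
        refine hx.not_forall_eq_pow hD _ σ τ (p := p) (m := a * s) (mul_ne_zero a.ne_zero hs)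
          fun i => ?_
        rw [pow_mul, ← hcard]
        exact h i
      subst hs
      refine ⟨rfl, ?_⟩
      refine AlgHom.ext fun y => ?_
      obtain ⟨-, A, B, -, -, -, rfl⟩ := hx.exists_eq_div y
      have hpoly : (σ.restrictScalars K).comp (MvPolynomial.aeval x) =
          (τ.restrictScalars K).comp (MvPolynomial.aeval x) := by
        ext i
        simpa using h i
      have hA := DFunLike.congr_fun hpoly A
      have hB := DFunLike.congr_fun hpoly B
      rw [map_div₀, map_div₀]
      exact congrArg₂ (· / ·) hA hB)
  have hdeg : X.gaussSepDegree = Fintype.card ι := Nat.card_eq_fintype_card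
  have h2 : (0 : ℚ) < (ε (Fin.last n) : ℚ) + (ℓ : ℚ) := by positivity
  rw [hdeg, le_div_iff₀ h2]
  exact_mod_cast hle
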